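/- **Theorem 4 (Two Linear Combinations).** Consider a memoryless $K$-user multiple-access channel with input alphabets $\mathcal X_1,\dots,\mathcal X_K$, output alphabet $\mathcal Y$ (discrete or continuous) and transition law $P_{Y|X_1,\dots,X_K}$. Let $\mathbb F$ be a field and $\boldsymbol a_1,\boldsymbol a_2\in\mathbb F^K$. *Codes.* A code of block length $n$ and rates $R_1,\dots,R_K\ge 0$ consists of message sets $\{0,\dots,\lceil 2^{nR_k}\rceil-1\}$, of encoders mapping each message $m_k$ to a pair of sequences $(u_k^n(m_k),x_k^n(m_k))\in\mathbb F^n\times\mathcal X_k^n$ with $m_k\mapsto u_k^n(m_k)$ injective, and of a (measurable) decoder mapping each $y^n\in\mathcal Y^n$ to estimates $(\hat w_{\boldsymbol a_1}^n,\hat w_{\boldsymbol a_2}^n)$ of $w^n_{\boldsymbol a_\ell}(m_1,\dots,m_K)=\sum_{k} a_{\ell k}u_k^n(m_k)$, $\ell=1,2$. The tuple $(R_1,\dots,R_K)$ is *achievable* for $(\boldsymbol a_1,\boldsymbol a_2)$ over $\mathbb F$ if there are such codes for all $n$ for which the probability that $(\hat w_{\boldsymbol a_1}^n,\hat w_{\boldsymbol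 a_2}^n)\ne(w_{\boldsymbol a_1}^n,w_{\boldsymbol a_2}^n)$, with independent and uniformly distributed messages and $x_1^n(m_1),\dots,x_K^n(m_K)$ sent over the channel, tends to $0$ as $n\to\infty$. *(i) Finite fields.* Let $\mathbb F=\mathbb A=\mathbb F_q$ and let $\boldsymbol a_1,\boldsymbol a_2\in\mathbb F_q^K$ be linearly independent. Put $\mathcal K_\ell=\{k: a_{\ell k}\ne 0\}$. Let $U_1,\dots,U_K$ be independent with arbitrary pmfs $p_{U_k}$ on $\mathbb F_q$, let $x_k(\cdot)$ be arbitrary symbol mappings into $\mathcal X_k$, let $Y$ be the output of the channel with inputs $X_k=x_k(U_k)$, and let $$W_{\boldsymbol a_\ell}=\sum_{k=1}^K a_{\ell k}U_k\ (\ell=1,2),\qquad V_{\boldsymbol b}=b_1W_{\boldsymbol a_1}+b_2W_{\boldsymbol a_2}\quad(\boldsymbol b\in\mathbb A^2\setminus\{\boldsymbol 0\}),$$ with operations in $\mathbb F$. Let $R_1,\dots,R_K\ge0$, with $R_k\le\log_2 q$ for the users $k\notin\mathcal K_1\cup\mathcal K_2$. Then $(R_1,\dots,R_K)$ is achievable for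 $(\boldsymbol a_1,\boldsymbol a_2)$ over $\mathbb F_q$ if (entropies in bits) $$\begin{aligned} R_k&<\max_{\boldsymbol b\in\mathbb A^2\setminus\{\boldsymbol 0\}}\min\{H(U_k)-H(V_{\boldsymbol b}|Y),\,H(U_k)-H(W_{\boldsymbol a_1},W_{\boldsymbol a_2}|Y,V_{\boldsymbol b})\}, && k\in\mathcal K_1,\\ R_j&<I(W_{\boldsymbol a_2};Y,W_{\boldsymbol a_1})-H(W_{\boldsymbol a_2})+H(U_j), && j\in\mathcal K_2,\\ R_k+R_j&<I(W_{\boldsymbol a_1},W_{\boldsymbol a_2};Y)-H(W_{\boldsymbol a_1},W_{\boldsymbol a_2})+H(U_k)+H(U_j), && k\in\mathcal K_1,\ j\in\mathcal K_2, \end{aligned}$$ or $$\begin{aligned} R_k&<I(W_{\boldsymbol a_1};Y,W_{\boldsymbol a_2})-H(W_{\boldsymbol a_1})+H(U_k), && k\in\mathcal K_1,\\ R_j&<\max_{\boldsymbol b\in\mathbb A^2\setminus\{\boldsymbol 0\}}\min\{H(U_j)-H(V_{\boldsymbol b}|Y),\,H(U_j)-H(W_{\boldsymbol a_1},W_{\boldsymbol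 a_2}|Y,V_{\boldsymbol b})\}, && j\in\mathcal K_2,\\ R_k+R_j&<I(W_{\boldsymbol a_1},W_{\boldsymbol a_2};Y)-H(W_{\boldsymbol a_1},W_{\boldsymbol a_2})+H(U_k)+H(U_j), && k\in\mathcal K_1,\ j\in\mathcal K_2. \end{aligned}$$ *(ii) Integer combinations over the reals.* The same holds with $\mathbb F=\mathbb R$ and $\mathbb A=\mathbb Z$: $\boldsymbol a_1,\boldsymbol a_2\in\mathbb Z^K$ linearly independent over $\mathbb R$, the $U_k$ integer-valued with finite supports, all sums taken in $\mathbb R$, and no upper restriction on $R_k$ for $k\notin\mathcal K_1\cup\mathcal K_2$. -/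

import Mathlib

open MeasureTheory ProbabilityTheory Filter Topology

namespace ComputeForward

noncomputable section

/-! ### Information measures (in bits) -/

/-- Entropy (in bits) of a probability measure on a countable alphabet. -/
def measureEntropy {S : Type*} [MeasurableSpace S] (ν : Measure S) : ℝ :=
  ∑' s : S, Real.negMulLog (ν.real {s}) / Real.log 2

/-- Entropy `H(W)` of a discrete random variable `W`. -/
def entropy {Ω S : Type*} [MeasurableSpace Ω] [MeasurableSpace S]
    (μ : Measure Ω) (W : Ω → S) : ℝ :=
  measureEntropy (μ.map W)

/-- Conditional entropy `H(W | T)` of a discrete random variable `W` given an arbitrary random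
variable `T`: the average over `t ∼ P_T` of the entropy of the conditional law of `W`
given `T = t`. -/
def condEntropy {Ω S 𝒯 : Type*} [MeasurableSpace Ω] [MeasurableSpace S] [StandardBorelSpace S]
    [Nonempty S] [MeasurableSpace 𝒯] (μ : Measure Ω) [IsFiniteMeasure μ]
    (W : Ω → S) (T : Ω → 𝒯) : ℝ :=
  ∫ t, measureEntropy (condDistrib W T μ t) ∂(μ.map T)

/-- Mutual information `I(W; T) = H(W) - H(W | T)` of a discrete random variable `W` and an
arbitrary random variable `T`. -/
def mutualInfo {Ω S 𝒯 : Type*} [MeasurableSpace Ω] [MeasurableSpace S] [StandardBorelSpace S]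
    [Nonempty S] [MeasurableSpace 𝒯] (μ : Measure Ω) [IsFiniteMeasure μ]
    (W : Ω → S) (T : Ω → 𝒯) : ℝ :=
  entropy μ W - condEntropy μ W T

/-! ### Codes for compute-forward -/

/-- The number of messages of a code of block length `n` and rate `r` bits per channel use,
that is `2 ^ (n r)`, rounded up to an integer. -/
def numMsgs (n : ℕ) (r : ℝ) : ℕ := ⌈(2 : ℝ) ^ ((n : ℝ) * r)⌉₊

/-- A code of block length `n` and rates `R` for recovering `L` linear combinations over the
field `𝔽` at the receiver of a `K`-user multiple-access channel with input alphabets `X k` and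
output alphabet `Y`. -/
structure Code (𝔽 : Type*) [MeasurableSpace 𝔽] {K : ℕ} (X : Fin K → Type*)
    (Y : Type*) [MeasurableSpace Y] (L : ℕ) (R : Fin K → ℝ) (n : ℕ) where
  /-- the representative `u_k^n(m_k) ∈ 𝔽^n` of each message -/
  u : ∀ k, Fin (numMsgs n (R k)) → Fin n → 𝔽
  u_injective : ∀ k, Function.Injective (u k)
  /-- the channel input sequence `x_k^n(m_k)` of each message -/
  x : ∀ k, Fin (numMsgs n (R k)) → Fin n → X k
  /-- the estimates of the `L` linear combinations -/
  dec : (Fin n → Y) → Fin L → Fin n → 𝔽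
  measurable_dec : Measurable dec

namespace Code

variable {𝔽 : Type*} [Field 𝔽] [MeasurableSpace 𝔽] {K : ℕ} {X : Fin K → Type*}
  [∀ k, MeasurableSpace (X k)] {Y : Type*} [MeasurableSpace Y] {L : ℕ} {R : Fin K → ℝ} {n : ℕ}

/-- The `L` linear combinations, with coefficients the rows of `A`, of the representatives of
the message tuple `m`. -/
def linearCombs (c : Code 𝔽 X Y L R n) (A : Fin L → Fin K → 𝔽)
    (m : ∀ k, Fin (numMsgs n (R k))) : Fin L → Fin n → 𝔽 :=
  fun l i => ∑ k, A l k * c.u k (m k) i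

/-- The average probability of error over the memoryless channel `W`, for independent and
uniformly distributed messages. -/
def errorProb (c : Code 𝔽 X Y L R n) (W : Kernel (∀ k, X k) Y) (A : Fin L → Fin K → 𝔽) : ℝ :=
  (∑ m : ∀ k, Fin (numMsgs n (R k)),
      (Measure.pi fun i : Fin n => W fun k => c.x k (m k) i).real
        {y | c.dec y ≠ c.linearCombs A m}) /
    ∏ k, (numMsgs n (R k) : ℝ)

end Code

/-- The rate tuple `R` is achievable over the channel `W` for recovering the linear
combinations over `𝔽` whose coefficient vectors are the rows of `A`. -/
def Achievable {𝔽 : Type*} [Field 𝔽] [MeasurableSpace 𝔽] {K : ℕ} {X : Fin K → Type*}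
    [∀ k, MeasurableSpace (X k)] {Y : Type*} [MeasurableSpace Y] {L : ℕ}
    (W : Kernel (∀ k, X k) Y) (A : Fin L → Fin K → 𝔽) (R : Fin K → ℝ) : Prop :=
  ∃ c : ∀ n : ℕ, Code 𝔽 X Y L R n, Tendsto (fun n => (c n).errorProb W A) atTop (𝓝 0)

/-! ### The single-letter rate region -/

theorem measurable_symbolMap {S : Type*} [MeasurableSpace S] [DiscreteMeasurableSpace S] {K : ℕ}
    {X : Fin K → Type*} [∀ k, MeasurableSpace (X k)] (x : ∀ k, S → X k) :
    Measurable fun (u : Fin K → S) (k : Fin K) => x k (u k) :=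
  measurable_pi_lambda _ fun k => (Measurable.of_discrete (f := x k)).comp (measurable_pi_apply k)

section Region

variable {S : Type*} [CommRing S] [Countable S] [MeasurableSpace S] [DiscreteMeasurableSpace S]
  {K : ℕ} {X : Fin K → Type*} [∀ k, MeasurableSpace (X k)] {Y : Type*} [MeasurableSpace Y]

/-- The joint law of `((U_1, …, U_K), Y)`: the `U_k` are independent with pmf's `p k`, and `Y` is
the output of the channel `W` with inputs `X_k = x_k(U_k)`. -/
def jointLaw (W : Kernel (∀ k, X k) Y) (p : Fin K → PMF S) (x : ∀ k, S → X k) :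
    Measure ((Fin K → S) × Y) :=
  (Measure.pi fun k => (p k).toMeasure) ⊗ₘ
    (W.comap (fun (u : Fin K → S) (k : Fin K) => x k (u k)) (measurable_symbolMap x))

instance (W : Kernel (∀ k, X k) Y) [IsMarkovKernel W] (p : Fin K → PMF S) (x : ∀ k, S → X k) :
    IsProbabilityMeasure (jointLaw W p x) := by
  unfold jointLaw; infer_instance

/-- The random variable `U_k`. -/
def rvU (Y : Type*) (k : Fin K) : (Fin K → S) × Y → S := fun ω => ω.1 k

/-- The random variable `Y`. -/
def rvY (S : Type*) (K : ℕ) (Y : Type*) : (Fin K → S) × Y → Y := fun ω => ω.2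

/-- The random variable `W_a = ∑ k, a_k U_k`. -/
def rvW (Y : Type*) (a : Fin K → S) : (Fin K → S) × Y → S := fun ω => ∑ k, a k * ω.1 k

/-- The random variable `V_b = b_1 W_{a₁} + b_2 W_{a₂}`. -/
def rvV (Y : Type*) (a₁ a₂ : Fin K → S) (b : Fin 2 → S) : (Fin K → S) × Y → S :=
  fun ω => b 0 * rvW Y a₁ ω + b 1 * rvW Y a₂ ω

variable (W : Kernel (∀ k, X k) Y) [IsMarkovKernel W] (p : Fin K → PMF S) (x : ∀ k, S → X k)
  (a₁ a₂ : Fin K → S)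

/-- `max_{b ≠ 0} min {H(U_k) - H(V_b | Y), H(U_k) - H(W_{a₁}, W_{a₂} | Y, V_b)}`. -/
def maxMinRate (k : Fin K) : ℝ :=
  ⨆ b : {b : Fin 2 → S // b ≠ 0},
    min (entropy (jointLaw W p x) (rvU Y k) -
          condEntropy (jointLaw W p x) (rvV Y a₁ a₂ b.1) (rvY S K Y))
        (entropy (jointLaw W p x) (rvU Y k) -
          condEntropy (jointLaw W p x) (fun ω => (rvW Y a₁ ω, rvW Y a₂ ω))
            (fun ω => (rvY S K Y ω, rvV Y a₁ a₂ b.1 ω)))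

/-- `I(W_a; Y, W_{a'}) - H(W_a) + H(U_k)`. -/
def singleRate (a a' : Fin K → S) (k : Fin K) : ℝ :=
  mutualInfo (jointLaw W p x) (rvW Y a) (fun ω => (rvY S K Y ω, rvW Y a' ω)) -
    entropy (jointLaw W p x) (rvW Y a) + entropy (jointLaw W p x) (rvU Y k)

/-- `I(W_{a₁}, W_{a₂}; Y) - H(W_{a₁}, W_{a₂}) + H(U_k) + H(U_j)`. -/
def sumRate (k j : Fin K) : ℝ :=
  mutualInfo (jointLaw W p x) (fun ω => (rvW Y a₁ ω, rvW Y a₂ ω)) (rvY S K Y) -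
    entropy (jointLaw W p x) (fun ω => (rvW Y a₁ ω, rvW Y a₂ ω)) +
    entropy (jointLaw W p x) (rvU Y k) + entropy (jointLaw W p x) (rvU Y j)

/-- The first set of rate constraints. -/
def region₁ : Set (Fin K → ℝ) :=
  {R | (∀ k, a₁ k ≠ 0 → R k < maxMinRate W p x a₁ a₂ k) ∧
    (∀ j, a₂ j ≠ 0 → R j < singleRate W p x a₂ a₁ j) ∧
    ∀ k j, a₁ k ≠ 0 → a₂ j ≠ 0 → R k + R j < sumRate W p x a₁ a₂ k j}

/-- The second set of rate constraints. -/
def region₂ : Set (Fin K → ℝ) :=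
  {R | (∀ k, a₁ k ≠ 0 → R k < singleRate W p x a₁ a₂ k) ∧
    (∀ j, a₂ j ≠ 0 → R j < maxMinRate W p x a₁ a₂ j) ∧
    ∀ k j, a₁ k ≠ 0 → a₂ j ≠ 0 → R k + R j < sumRate W p x a₁ a₂ k j}

end Region

end

end ComputeForward

/-! The proof is a random coding argument with linear hashes. Over a finite field with q elements a
matrix `Q` is shared by all users, and the hash of a sequence consists of its products with the
first rows of `Q`. Each message of user k prescribes a hash value: the first rows (`frozen`) equal a
shift known to the receiver, the following rows carry the message. The codeword is drawn from the
i.i.d. law of U_k conditioned on that value. By `leftover_hash`, the hash of an i.i.d. sequence is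
nearly uniform if it is shorter than n H(U_k), so by `exists_codebook` the codewords behave like
independent i.i.d. sequences. Hashing is linear; if all users in K_l freeze n φ_l nats, the receiver
knows that much of the hash of w_l, at the price R_k + φ_l < H(U_k) (in common units). Indices l are
0 and 1 as in the code.

The decoder looks for the only typical pair with the known hashes. Let δ be the difference of a
wrong and the true pair. If δ_0, δ_1 are linearly independent, the hashes agree with probability
about exp(-n(φ_0+φ_1)), against about exp(n H(W_0,W_1|Y)) candidates. If b·δ = 0 with b ≠ 0, the
candidates share V_b, so there are about exp(n H(W_0,W_1|Y,V_b)) of them; the hashes agree with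
probability at most about exp(-n φ_0) if b_1 ≠ 0, and exp(-n φ_1) if b_0 ≠ 0. Typicality is a
one-sided threshold on conditional pmf's, so candidates are counted just from the fact that a pmf
sums to at most 1 (`sum_typicalSet_le`, `sum_confusable_le`).

It remains to choose φ. For a fixed c, every direction b ≠ 0 costs at most max{H(V_c|Y),
H(W_0,W_1|Y,V_c)}: either b is parallel to the reduction of c and the conditioning is on at least as
much as V_c, or V_b and V_c together determine the pair (`IsReduction.hasRate_successive`). For the
first region, φ_0 exceeds this maximum and handles all b with b_1 ≠ 0; φ_1 exceeds H(W_1|Y,W_0) and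
handles b_1 = 0; and φ_0+φ_1 exceeds H(W_0,W_1|Y). The second region is symmetric.
`exists_hash_rates` finds such φ from the rate constraints.

For integers, everything is reduced modulo a prime so large that all relevant integers are recovered
from their residues; laws, entropies and codes are then carried across the reduction
(`hasRate_condEntropy`, `achievable_of_hasRate`). -/

namespace ComputeForward

/-! ### Random linear hashing -/

section Hashing

open scoped Classical

/-- The number of vectors orthogonal to a linearly independent family. -/
theorem card_orthogonal {F ι n : Type*} [Field F] [Fintype F] [Fintype ι] [Fintype n]
    (δ : ι → n → F) (hδ : LinearIndependent F δ) :
    Nat.card {r : n → F // ∀ l, r ⬝ᵥ δ l = 0} * Fintype.card F ^ Fintype.card ι =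
      Fintype.card F ^ Fintype.card n := by
  let L : (n → F) →ₗ[F] (ι → F) :=
    { toFun := fun r l => r ⬝ᵥ δ l
      map_add' := fun r s => by ext l; simp [add_dotProduct]
      map_smul' := fun c r => by ext l; simp [smul_dotProduct] }
  have hL : ∀ r l, L r l = r ⬝ᵥ δ l := fun _ _ => rfl
  -- A proper range would be annihilated by a nonzero functional, whose coefficients are a linear
  -- relation among the `δ l`.
  have hsurj : Function.Surjective L := by
    rw [← LinearMap.range_eq_top]
    by_contra hne
    obtain ⟨f, hf0, hf⟩ := Submodule.exists_le_ker_of_lt_top _ (lt_top_iff_ne_top.2 hne)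
    apply hf0
    have hb : ∀ l, f (fun j => if l = j then 1 else 0) = 0 := by
      refine (Fintype.linearIndependent_iff.1 hδ) (fun l => f fun j => if l = j then 1 else 0) ?_
      ext j
      have h1 : f (L (Pi.single j 1)) = 0 := hf ⟨_, rfl⟩
      rw [LinearMap.pi_apply_eq_sum_univ f] at h1
      simpa [hL, single_dotProduct, mul_comm] using h1
    refine LinearMap.ext fun v => ?_
    rw [LinearMap.pi_apply_eq_sum_univ f]
    simp [hb]
  have h1 := Submodule.card_eq_card_quotient_mul_card (LinearMap.ker L)
  have h2 := Nat.card_congr (L.quotKerEquivOfSurjective hsurj).toEquiv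
  have h3 : Nat.card (LinearMap.ker L) = Nat.card {r : n → F // ∀ l, r ⬝ᵥ δ l = 0} :=
    Nat.card_congr (Equiv.subtypeEquivRight fun r => by
      rw [LinearMap.mem_ker]
      exact ⟨fun h l => congrFun h l, fun h => funext h⟩)
  rw [h2, h3] at h1
  simp only [Nat.card_eq_fintype_card, Fintype.card_fun] at h1
  rw [Nat.card_eq_fintype_card, h1, mul_comm]

theorem linearIndependent_single {F V : Type*} [Field F] [AddCommGroup V] [Module F V]
    {v : V} (hv : v ≠ 0) : LinearIndependent F (fun _ : Unit => v) :=
  linearIndependent_unique_iff.2 hv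

/-- A uniformly random matrix annihilates a linearly independent family, the member `l` with its
first `f l` rows, with probability at most `q ^ (-∑ l, f l)`. -/
theorem sum_annihilate_le {F ι : Type*} [Field F] [Fintype F] [Fintype ι] {N n : ℕ}
    (f : ι → ℕ) (hf : ∀ l, f l ≤ N) (δ : ι → Fin n → F) (hδ : LinearIndependent F δ) :
    (∑ Q : Fin N → Fin n → F, if ∀ l, ∀ i : Fin N, i.1 < f l → Q i ⬝ᵥ δ l = 0 then (1 : ℝ) else 0) ≤
      Fintype.card (Fin N → Fin n → F) * ((Fintype.card F : ℝ) ^ (∑ l, f l))⁻¹ := by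
  have hq : 0 < Fintype.card F := Fintype.card_pos
  -- The rows of `Q` are chosen independently; row `i` obeys one linear constraint for each `l` with
  -- `i < f l`, and over all rows these constraints number `∑ l, f l`.
  have hrow : ∀ i : Fin N, Nat.card {r : Fin n → F // ∀ l, i.1 < f l → r ⬝ᵥ δ l = 0} *
      Fintype.card F ^ Fintype.card {l // i.1 < f l} = Fintype.card F ^ n := by
    intro i
    have h := card_orthogonal (fun l : {l // i.1 < f l} => δ l.1)
      (hδ.comp _ Subtype.val_injective)
    rw [Fintype.card_fin] at h
    rw [← h]
    congr 1
    exact Nat.card_congr (Equiv.subtypeEquivRight fun r => by simp)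
  have hsum : ∑ i : Fin N, Fintype.card {l // i.1 < f l} = ∑ l, f l := by
    simp only [Fintype.card_subtype, Finset.card_filter]
    rw [Finset.sum_comm]
    refine Finset.sum_congr rfl fun l _ => ?_
    rw [← Finset.card_filter, ← Fintype.card_subtype]
    have := Fintype.card_congr (Fin.castLEquiv (hf l))
    simpa using this.symm
  have hcard : Nat.card {Q : Fin N → Fin n → F // ∀ l, ∀ i : Fin N, i.1 < f l → Q i ⬝ᵥ δ l = 0} *
      Fintype.card F ^ (∑ l, f l) = Fintype.card (Fin N → Fin n → F) := by
    have e : {Q : Fin N → Fin n → F // ∀ l, ∀ i : Fin N, i.1 < f l → Q i ⬝ᵥ δ l = 0} ≃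
        ∀ i : Fin N, {r : Fin n → F // ∀ l, i.1 < f l → r ⬝ᵥ δ l = 0} :=
      (Equiv.subtypeEquivRight fun Q => by
        exact ⟨fun h i l => h l i, fun h l i => h i l⟩).trans
        (Equiv.subtypePiEquivPi (p := fun (i : Fin N) (r : Fin n → F) =>
          ∀ l, i.1 < f l → r ⬝ᵥ δ l = 0))
    rw [Nat.card_congr e, Nat.card_pi, ← hsum, ← Finset.prod_pow_eq_pow_sum,
      ← Finset.prod_mul_distrib, Finset.prod_congr rfl fun i _ => hrow i]
    simp
  rw [Finset.sum_boole, ← Fintype.card_subtype, ← Nat.card_eq_fintype_card,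
    le_mul_inv_iff₀ (by positivity)]
  exact_mod_cast hcard.le

end Hashing

/-! ### Leftover hash lemma -/

section Finite

open scoped Classical

/-- Leftover hash lemma: for a 2-universal family of hash functions, the law of the hash of a
random variable with pmf `P` is close to uniform if the hash is short. -/
theorem leftover_hash {Θ V S : Type*} [Fintype Θ] [Fintype V] [Fintype S] [Nonempty S]
    [DecidableEq S]
    (h : Θ → V → S) (P : V → ℝ) (hP0 : ∀ u, 0 ≤ P u) (hP1 : ∑ u, P u = 1)
    (huniv : ∀ u u', u ≠ u' →
      (∑ θ, if h θ u = h θ u' then (1 : ℝ) else 0) ≤ Fintype.card Θ * (Fintype.card S : ℝ)⁻¹)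
    (M : ℝ) (hM0 : 0 ≤ M) (A : V → Prop) [DecidablePred A] (hA : ∀ u, A u → P u ≤ M) :
    ∑ θ, ∑ s, |(Fintype.card S : ℝ)⁻¹ - ∑ u, if h θ u = s then P u else 0| ≤
      Fintype.card Θ * (2 * (∑ u, if A u then 0 else P u) + √(Fintype.card S * M)) := by
  set c : ℝ := (Fintype.card S : ℝ)⁻¹ with hc
  have hS : (0 : ℝ) < Fintype.card S := by exact_mod_cast Fintype.card_pos
  have hc0 : 0 ≤ c := by positivity
  have hSc : Fintype.card S * c = 1 := mul_inv_cancel₀ hS.ne'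
  -- The part `PA` with small point masses is treated by second moments. The rest `PB` is bounded in
  -- L¹ and enters twice, through its own hash and through the mass missing from `PA`; hence the
  -- factor 2.
  set PA : V → ℝ := fun u => if A u then P u else 0 with hPA
  set PB : V → ℝ := fun u => if A u then 0 else P u with hPB
  have hPAB : ∀ u, P u = PA u + PB u := fun u => by simp only [hPA, hPB]; split_ifs <;> simp
  have hPA0 : ∀ u, 0 ≤ PA u := fun u => by simp only [hPA]; split_ifs <;> simp [hP0]
  have hPB0 : ∀ u, 0 ≤ PB u := fun u => by simp only [hPB]; split_ifs <;> simp [hP0]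
  set a : ℝ := ∑ u, PA u with ha
  set b : ℝ := ∑ u, PB u with hb
  have hab : a + b = 1 := by
    rw [ha, hb, ← Finset.sum_add_distrib, ← hP1]
    exact Finset.sum_congr rfl fun u _ => (hPAB u).symm
  have ha1 : a ≤ 1 := by
    have : 0 ≤ b := Finset.sum_nonneg fun u _ => hPB0 u
    linarith
  have ha0 : 0 ≤ a := Finset.sum_nonneg fun u _ => hPA0 u
  have hb0 : 0 ≤ b := Finset.sum_nonneg fun u _ => hPB0 u
  let qA : Θ → S → ℝ := fun θ s => ∑ u, if h θ u = s then PA u else 0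
  let qB : Θ → S → ℝ := fun θ s => ∑ u, if h θ u = s then PB u else 0
  have hqB0 : ∀ θ s, 0 ≤ qB θ s := fun θ s =>
    Finset.sum_nonneg fun u _ => by split_ifs <;> simp [hPB0]
  have fiber : ∀ (f : V → ℝ) θ, ∑ s, (∑ u, if h θ u = s then f u else 0) = ∑ u, f u := by
    intro f θ
    rw [Finset.sum_comm]
    simp
  have hM : ∑ u, PA u ^ 2 ≤ M := by
    have : ∀ u, PA u ^ 2 ≤ M * PA u := by
      intro u
      by_cases hu : A u
      · simp only [hPA, hu, if_true, sq]
        exact mul_le_mul_of_nonneg_right (hA u hu) (hP0 u)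
      · simp [hPA, hu]
    calc ∑ u, PA u ^ 2 ≤ ∑ u, M * PA u := Finset.sum_le_sum fun u _ => this u
      _ = M * a := by rw [Finset.mul_sum]
      _ ≤ M := by nlinarith
  have hsq : ∀ θ, ∑ s, (qA θ s) ^ 2 = ∑ u, ∑ u', (if h θ u = h θ u' then 1 else 0) * (PA u * PA u') := by
    intro θ
    have h1 : ∀ s, (qA θ s) ^ 2 =
        ∑ u, if h θ u = s then (∑ u', if h θ u = h θ u' then PA u * PA u' else 0) else 0 := by
      intro s
      simp only [qA, sq, Finset.sum_mul_sum]
      refine Finset.sum_congr rfl fun u _ => ?_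
      split_ifs with hu
      · refine Finset.sum_congr rfl fun u' _ => ?_
        rw [← hu]
        by_cases h' : h θ u = h θ u'
        · simp [h']
        · simp [h', Ne.symm h']
      · simp
    simp only [h1]
    rw [fiber (fun u => ∑ u', if h θ u = h θ u' then PA u * PA u' else 0)]
    simp
  -- Diagonal pairs contribute `∑ PA² ≤ M`; universality bounds the other pairs by what a uniform
  -- hash would give.
  have hcoll : ∑ θ, ∑ s, (qA θ s) ^ 2 ≤ Fintype.card Θ * (M + c * a ^ 2) := by
    simp only [hsq]
    rw [Finset.sum_comm]
    have h1 : ∀ u, ∑ θ, ∑ u', (if h θ u = h θ u' then (1 : ℝ) else 0) * (PA u * PA u') ≤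
        Fintype.card Θ * PA u ^ 2 + ∑ u', Fintype.card Θ * c * (PA u * PA u') := by
      intro u
      rw [Finset.sum_comm]
      have h2 : ∀ u', ∑ θ, (if h θ u = h θ u' then (1 : ℝ) else 0) * (PA u * PA u') ≤
          (if u = u' then Fintype.card Θ * PA u ^ 2 else 0) +
            Fintype.card Θ * c * (PA u * PA u') := by
        intro u'
        have hpos : 0 ≤ PA u * PA u' := mul_nonneg (hPA0 _) (hPA0 _)
        rw [← Finset.sum_mul]
        split_ifs with hu
        · subst hu
          simp only [if_true, Finset.sum_const, Finset.card_univ, nsmul_eq_mul, mul_one]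
          have : 0 ≤ Fintype.card Θ * c * (PA u * PA u) := by positivity
          nlinarith
        · rw [zero_add]
          exact mul_le_mul_of_nonneg_right (huniv u u' hu) hpos
      refine (Finset.sum_le_sum fun u' _ => h2 u').trans ?_
      rw [Finset.sum_add_distrib]
      simp
    refine (Finset.sum_le_sum fun u _ => h1 u).trans ?_
    rw [Finset.sum_add_distrib, ← Finset.mul_sum]
    have h3 : ∑ u, ∑ u', Fintype.card Θ * c * (PA u * PA u') = Fintype.card Θ * c * a ^ 2 := by
      simp only [← Finset.mul_sum]
      rw [ha, sq, Finset.sum_mul]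
    rw [h3]
    have : (0 : ℝ) ≤ Fintype.card Θ := by positivity
    nlinarith
  have hvar : ∑ θ, ∑ s, (qA θ s - c * a) ^ 2 ≤ Fintype.card Θ * M := by
    have h1 : ∀ θ, ∑ s, (qA θ s - c * a) ^ 2 = ∑ s, (qA θ s) ^ 2 - c * a ^ 2 := by
      intro θ
      have h2 : ∑ s, qA θ s = a := fiber PA θ
      have h3 : ∀ s, (qA θ s - c * a) ^ 2 = qA θ s ^ 2 - 2 * c * a * qA θ s + (c * a) ^ 2 :=
        fun s => by ring
      simp only [h3, Finset.sum_add_distrib, Finset.sum_sub_distrib, ← Finset.mul_sum, h2,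
        Finset.sum_const, Finset.card_univ, nsmul_eq_mul]
      linear_combination (c * a ^ 2) * hSc
    simp only [h1, Finset.sum_sub_distrib, Finset.sum_const, Finset.card_univ, nsmul_eq_mul]
    linarith
  -- Cauchy–Schwarz over all pairs `(θ, s)`.
  have hL1 : ∑ θ, ∑ s, |qA θ s - c * a| ≤ Fintype.card Θ * √(Fintype.card S * M) := by
    rw [← Finset.sum_product', ]
    have h1 := sq_sum_le_card_mul_sum_sq (s := (Finset.univ : Finset Θ) ×ˢ (Finset.univ : Finset S))
      (f := fun x => |qA x.1 x.2 - c * a|)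
    simp only [sq_abs] at h1
    rw [Finset.sum_product (f := fun x : Θ × S => (qA x.1 x.2 - c * a) ^ 2), Finset.card_product,
      Finset.card_univ, Finset.card_univ] at h1
    push_cast at h1
    refine abs_le_of_sq_le_sq' ?_ (by positivity) |>.2
    rw [mul_pow, Real.sq_sqrt (by positivity)]
    refine h1.trans ?_
    calc (Fintype.card Θ * Fintype.card S : ℝ) * ∑ x, ∑ y, (qA x y - c * a) ^ 2
        ≤ (Fintype.card Θ * Fintype.card S : ℝ) * (Fintype.card Θ * M) :=
          mul_le_mul_of_nonneg_left hvar (by positivity)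
      _ = _ := by ring
  have hpt : ∀ θ s, |c - ∑ u, if h θ u = s then P u else 0| ≤
      |qA θ s - c * a| + (qB θ s + c * b) := by
    intro θ s
    have h1 : (∑ u, if h θ u = s then P u else 0) = qA θ s + qB θ s := by
      simp only [qA, qB, ← Finset.sum_add_distrib]
      refine Finset.sum_congr rfl fun u _ => ?_
      split_ifs <;> simp [hPAB u]
    rw [h1]
    have h2 : c - (qA θ s + qB θ s) = -(qA θ s - c * a) + (-qB θ s + c * b) := by
      linear_combination (-c) * hab
    rw [h2]
    refine (abs_add_le _ _).trans ?_
    rw [abs_neg]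
    gcongr
    refine (abs_add_le _ _).trans ?_
    rw [abs_neg, abs_of_nonneg (hqB0 θ s), abs_of_nonneg (mul_nonneg hc0 hb0)]
  refine (Finset.sum_le_sum fun θ _ => Finset.sum_le_sum fun s _ => hpt θ s).trans ?_
  simp only [Finset.sum_add_distrib]
  have h4 : ∀ θ, ∑ s, qB θ s = b := fun θ => fiber PB θ
  simp only [h4, Finset.sum_const, Finset.card_univ, nsmul_eq_mul]
  have h5 : (Fintype.card S : ℝ) * (c * b) = b := by rw [← mul_assoc, hSc, one_mul]
  rw [h5]
  linarith

end Finite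

/-! ### Random codebooks with prescribed hash values -/

section Finite

open scoped Classical

/-- The total variation distance of product laws is at most the sum of those of the factors. -/
theorem sum_abs_prod_sub_le {K : ℕ} {Z : Fin K → Type*} [∀ k, Fintype (Z k)]
    (f g : ∀ k, Z k → ℝ) (hf0 : ∀ k z, 0 ≤ f k z) (hg0 : ∀ k z, 0 ≤ g k z)
    (hf : ∀ k, ∑ z, f k z = 1) (hg : ∀ k, ∑ z, g k z = 1) :
    ∑ z : ∀ k, Z k, |∏ k, f k (z k) - ∏ k, g k (z k)| ≤ ∑ k, ∑ z, |f k z - g k z| := by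
  -- Hybrid argument: in the `i`-th term of the telescoping sum the coordinates below `i` follow
  -- `g`, those above follow `f`, and only coordinate `i` carries a difference.
  have key : ∀ z : ∀ k, Z k, |∏ k, f k (z k) - ∏ k, g k (z k)| ≤
      ∑ i, ∏ k, (if k < i then g k (z k) else if k = i then |f k (z k) - g k (z k)|
        else f k (z k)) := by
    intro z
    have h := Finset.prod_sub_ordered Finset.univ (fun k => f k (z k))
      (fun k => f k (z k) - g k (z k))
    simp only [sub_sub_cancel] at h
    rw [h, sub_sub_cancel]
    refine (Finset.abs_sum_le_sum_abs _ _).trans (Finset.sum_le_sum fun i _ => le_of_eq ?_)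
    rw [abs_mul, abs_mul, abs_of_nonneg (Finset.prod_nonneg fun k _ => hg0 k (z k)),
      abs_of_nonneg (Finset.prod_nonneg fun k _ => hf0 k (z k)), Finset.prod_ite,
      Finset.prod_ite, Finset.filter_filter, Finset.filter_filter]
    have h1 : (Finset.univ.filter fun k : Fin K => ¬k < i ∧ k = i) = {i} := by
      ext k
      simp only [Finset.mem_filter, Finset.mem_univ, true_and, Finset.mem_singleton]
      constructor
      · exact fun h => h.2
      · rintro rfl
        simp
    have h2 : (Finset.univ.filter fun k : Fin K => ¬k < i ∧ ¬k = i) =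
        Finset.univ.filter fun k => i < k := by
      ext k
      simp only [Finset.mem_filter, Finset.mem_univ, true_and]
      constructor
      · exact fun h => lt_of_le_of_ne (not_lt.1 h.1) (Ne.symm h.2)
      · exact fun h => ⟨not_lt.2 h.le, h.ne'⟩
    rw [h1, h2, Finset.prod_singleton]
    ring
  refine (Finset.sum_le_sum fun z _ => key z).trans ?_
  rw [Finset.sum_comm]
  refine Finset.sum_le_sum fun i _ => le_of_eq ?_
  have h := Finset.prod_univ_sum (fun k => (Finset.univ : Finset (Z k))) (fun k z =>
    if k < i then g k z else if k = i then |f k z - g k z| else f k z)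
  rw [Fintype.piFinset_univ] at h
  rw [← h]
  rw [Finset.prod_eq_single i]
  · simp
  · intro k _ hk
    rcases lt_or_gt_of_ne hk with hlt | hlt
    · simp [hlt, hg]
    · simp [not_lt.2 hlt.le, hk, hf]
  · simp

/-- Marginals of a product law. -/
theorem sum_prod_comp {I J V : Type*} [Fintype I] [Fintype J] [Fintype V]
    [DecidableEq I] [DecidableEq J] (ν : I → V → ℝ)
    (hν : ∀ i, ∑ v, ν i v = 1) (e : J → I) (he : Function.Injective e) (Φ : (J → V) → ℝ) :
    ∑ g : I → V, (∏ i, ν i (g i)) * Φ (fun j => g (e j)) =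
      ∑ v : J → V, (∏ j, ν (e j) (v j)) * Φ v := by
  have h1 : ∀ g : I → V, (∏ i, ν i (g i)) * Φ (fun j => g (e j)) =
      ∑ v : J → V, if (fun j => g (e j)) = v then (∏ i, ν i (g i)) * Φ v else 0 := by
    intro g
    simp
  simp only [h1]
  rw [Finset.sum_comm]
  refine Finset.sum_congr rfl fun v _ => ?_
  -- Prescribing the coordinates in the range of `e` is a product condition, so the sum over `g`
  -- factors; free coordinates contribute 1.
  have h2 : ∀ g : I → V, (if (fun j => g (e j)) = v then (∏ i, ν i (g i)) * Φ v else 0) =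
      (∏ i, if ∀ j, e j = i → g i = v j then ν i (g i) else 0) * Φ v := by
    intro g
    by_cases hg : (fun j => g (e j)) = v
    · rw [if_pos hg]
      congr 1
      refine Finset.prod_congr rfl fun i _ => ?_
      rw [if_pos]
      rintro j rfl
      exact congrFun hg j
    · rw [if_neg hg]
      obtain ⟨j, hj⟩ : ∃ j, g (e j) ≠ v j := by
        by_contra hcon
        push Not at hcon
        exact hg (funext hcon)
      rw [Finset.prod_eq_zero (Finset.mem_univ (e j)), zero_mul]
      rw [if_neg]
      exact fun h => hj (h j rfl)
  simp only [h2]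
  rw [← Finset.sum_mul]
  congr 1
  have h := Finset.prod_univ_sum (fun _ : I => (Finset.univ : Finset V)) (fun i x =>
    if ∀ j, e j = i → x = v j then ν i x else 0)
  rw [Fintype.piFinset_univ] at h
  rw [← h]
  symm
  refine Fintype.prod_of_injective e he _ _ ?_ ?_
  · intro i hi
    rw [← hν i]
    refine Finset.sum_congr rfl fun x _ => if_pos ?_
    rintro j rfl
    exact absurd ⟨j, rfl⟩ hi
  · intro j
    rw [Finset.sum_eq_single (v j)]
    · rw [if_pos]
      intro j' hj'
      rw [he hj']
    · intro x _ hx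
      rw [if_neg]
      exact fun h => hx (h j rfl)
    · simp

/-- Given hash functions `h k` and laws `P k` whose hashes are nearly uniform, there are shifts
`D k` and codebooks `c k` of sequences with prescribed hash values, whose average
error is not much worse than the error `e` for independent sequences with laws `P k`. -/
theorem exists_codebook {K : ℕ} {V : Type*} [Fintype V] {S : Fin K → Type*} [∀ k, Fintype (S k)]
    [∀ k, DecidableEq (S k)] [∀ k, AddGroup (S k)] (h : ∀ k, V → S k) (P : Fin K → V → ℝ) (hP0 : ∀ k u, 0 ≤ P k u)
    (hP1 : ∀ k, ∑ u, P k u = 1) {M : Fin K → Type*} [∀ k, Fintype (M k)] (ι : ∀ k, M k → S k)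
    (e : (Fin K → V) → ℝ) (he0 : ∀ u, 0 ≤ e u) (he1 : ∀ u, e u ≤ 1) :
    ∃ (D : ∀ k, S k) (c : ∀ k, M k → V),
      ∑ m : ∀ k, M k, (if ∀ k, h k (c k (m k)) = ι k (m k) + D k ∧ 0 < P k (c k (m k))
        then e (fun k => c k (m k)) else 1) ≤
      (∏ k, (Fintype.card (M k) : ℝ)) * (∑ u : Fin K → V, (∏ k, P k (u k)) * e u +
        ∑ k, ∑ s, |(Fintype.card (S k) : ℝ)⁻¹ - ∑ u, if h k u = s then P k u else 0|) := by
  let μ : ∀ k, S k → ℝ := fun k s => ∑ u, if h k u = s then P k u else 0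
  have hμ0 : ∀ k s, 0 ≤ μ k s := fun k s =>
    Finset.sum_nonneg fun u _ => by split_ifs <;> simp [hP0]
  have hV : ∀ k : Fin K, Nonempty V := by
    intro k
    by_contra hne
    have : IsEmpty V := not_nonempty_iff.1 hne
    simpa using hP1 k
  let u₀ : ∀ k : Fin K, V := fun k => (hV k).some
  -- Conditional law of the sequence given its hash. At hash values of probability zero an arbitrary
  -- point mass keeps it a probability law.
  let ν : ∀ k, S k → V → ℝ := fun k s u =>
    if μ k s = 0 then (if u = u₀ k then 1 else 0) else (if h k u = s then P k u / μ k s else 0)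
  have hν0 : ∀ k s u, 0 ≤ ν k s u := by
    intro k s u
    simp only [ν]
    split_ifs <;> first | positivity | exact div_nonneg (hP0 _ _) (hμ0 _ _)
  have hν1 : ∀ k s, ∑ u, ν k s u = 1 := by
    intro k s
    simp only [ν]
    split_ifs with hs
    · simp
    · have : ∀ u, (if h k u = s then P k u / μ k s else 0) =
          (if h k u = s then P k u else 0) / μ k s := fun u => by split_ifs <;> simp
      simp only [this]
      rw [← Finset.sum_div]
      exact div_self hs
  -- A sequence with the wrong hash or of probability zero, as the default point mass may produce,
  -- counts as an error.
  let err : (∀ k, S k × V) → ℝ := fun z =>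
    if ∀ k, h k (z k).2 = (z k).1 ∧ 0 < P k (z k).2 then e (fun k => (z k).2) else 1
  have herr0 : ∀ z, 0 ≤ err z := fun z => by
    simp only [err]; split_ifs
    · exact he0 _
    · exact zero_le_one
  have herr1 : ∀ z, err z ≤ 1 := fun z => by
    simp only [err]; split_ifs
    · exact he1 _
    · exact le_rfl
  set B : ℝ := ∑ u : Fin K → V, (∏ k, P k (u k)) * e u +
        ∑ k, ∑ s, |(Fintype.card (S k) : ℝ)⁻¹ - μ k s| with hB
  -- `ω` is the law of (hash, codeword) when the hash is uniform, `ω'` that of an i.i.d. sequence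
  -- with its own hash. Both have the conditional law `ν`, so their distance is that of the hash
  -- from uniform.
  let ω : ∀ k, S k × V → ℝ := fun k z => (Fintype.card (S k) : ℝ)⁻¹ * ν k z.1 z.2
  let ω' : ∀ k, S k × V → ℝ := fun k z => if h k z.2 = z.1 then P k z.2 else 0
  by_cases hS : ∃ k, IsEmpty (S k)
  · obtain ⟨k, hk⟩ := hS
    exact (IsEmpty.false (h k (u₀ k))).elim
  push Not at hS
  have hSne : ∀ k, Nonempty (S k) := fun k => hS k
  have hcard : ∀ k, (0 : ℝ) < Fintype.card (S k) := fun k => by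
    exact_mod_cast Fintype.card_pos
  have hω1 : ∀ k, ∑ z, ω k z = 1 := by
    intro k
    rw [Fintype.sum_prod_type]
    simp only [ω, ← Finset.mul_sum, hν1]
    simp [(hcard k).ne']
  have hω'1 : ∀ k, ∑ z, ω' k z = 1 := by
    intro k
    rw [Fintype.sum_prod_type, Finset.sum_comm]
    simp [ω', hP1]
  have hdist : ∀ k, ∑ z, |ω k z - ω' k z| = ∑ s, |(Fintype.card (S k) : ℝ)⁻¹ - μ k s| := by
    intro k
    rw [Fintype.sum_prod_type]
    refine Finset.sum_congr rfl fun s _ => ?_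
    by_cases hs : μ k s = 0
    · have hz : ∀ u, ω' k (s, u) = 0 := by
        intro u
        have := (Finset.sum_eq_zero_iff_of_nonneg (fun u _ => by
          split_ifs <;> simp [hP0])).1 hs u (Finset.mem_univ u)
        exact this
      simp only [hz, sub_zero, hs]
      have : ∀ u, |ω k (s, u)| = (Fintype.card (S k) : ℝ)⁻¹ * ν k s u := fun u =>
        abs_of_nonneg (mul_nonneg (inv_nonneg.2 (hcard k).le) (hν0 _ _ _))
      simp only [this, ← Finset.mul_sum, hν1, mul_one]
      rw [abs_of_nonneg (inv_nonneg.2 (hcard k).le)]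
    · have hspos : 0 < μ k s := lt_of_le_of_ne (hμ0 k s) (Ne.symm hs)
      have : ∀ u, |ω k (s, u) - ω' k (s, u)| =
          (|(Fintype.card (S k) : ℝ)⁻¹ - μ k s| / μ k s) * (if h k u = s then P k u else 0) := by
        intro u
        simp only [ω, ω', ν, if_neg hs]
        split_ifs with hu
        · rw [show (Fintype.card (S k) : ℝ)⁻¹ * (P k u / μ k s) - P k u =
            ((Fintype.card (S k) : ℝ)⁻¹ - μ k s) * (P k u / μ k s) by field_simp, abs_mul,
            abs_of_nonneg (div_nonneg (hP0 k u) hspos.le)]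
          ring
        · simp
      simp only [this, ← Finset.mul_sum]
      exact div_mul_cancel₀ _ hs
  let split : (∀ k, S k × V) ≃ (∀ k, S k) × (Fin K → V) :=
    ⟨fun z => (fun k => (z k).1, fun k => (z k).2), fun p k => (p.1 k, p.2 k),
      fun _ => rfl, fun _ => rfl⟩
  have hmain : ∑ z : ∀ k, S k × V, (∏ k, ω k (z k)) * err z ≤ B := by
    have h1 : ∑ z : ∀ k, S k × V, (∏ k, ω k (z k)) * err z ≤
        ∑ z : ∀ k, S k × V, (∏ k, ω' k (z k)) * err z +
          ∑ z : ∀ k, S k × V, |∏ k, ω k (z k) - ∏ k, ω' k (z k)| := by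
      rw [← Finset.sum_add_distrib]
      refine Finset.sum_le_sum fun z _ => ?_
      have h2 : (∏ k, ω k (z k) - ∏ k, ω' k (z k)) * err z ≤
          |∏ k, ω k (z k) - ∏ k, ω' k (z k)| * 1 :=
        mul_le_mul (le_abs_self _) (herr1 z) (herr0 z) (abs_nonneg _)
      linarith
    have h3 := sum_abs_prod_sub_le ω ω'
      (fun k z => mul_nonneg (inv_nonneg.2 (hcard k).le) (hν0 _ _ _))
      (fun k z => by simp only [ω']; split_ifs <;> simp [hP0]) hω1 hω'1
    simp only [hdist] at h3
    have h4 : ∑ z : ∀ k, S k × V, (∏ k, ω' k (z k)) * err z =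
        ∑ u : Fin K → V, (∏ k, P k (u k)) * e u := by
      rw [← split.symm.sum_comp, Fintype.sum_prod_type, Finset.sum_comm]
      refine Finset.sum_congr rfl fun u _ => ?_
      rw [Finset.sum_eq_single (fun k => h k (u k))]
      · simp only [split, Equiv.coe_fn_symm_mk, ω', if_true, err, true_and]
        split_ifs with hu
        · rfl
        · push Not at hu
          obtain ⟨k, hk⟩ := hu
          have : P k (u k) = 0 := le_antisymm hk (hP0 _ _)
          rw [Finset.prod_eq_zero (Finset.mem_univ k) this, zero_mul, zero_mul]
      · intro s _ hs
        obtain ⟨k, hk⟩ := Function.ne_iff.1 hs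
        rw [Finset.prod_eq_zero (Finset.mem_univ k), zero_mul]
        exact if_neg hk.symm
      · simp
    rw [hB, ← h4]
    linarith
  -- Given the shifts `D`, all codewords of all users are drawn independently.
  let w : (∀ k, S k) → ((Σ k, M k) → V) → ℝ := fun D c =>
    ∏ i : Σ k, M k, ν i.1 (ι i.1 i.2 + D i.1) (c i)
  let Err : (∀ k, S k) → ((Σ k, M k) → V) → ℝ := fun D c =>
    ∑ m : ∀ k, M k, err fun k => (ι k (m k) + D k, c ⟨k, m k⟩)
  have hw0 : ∀ D c, 0 ≤ w D c := fun D c => Finset.prod_nonneg fun i _ => hν0 _ _ _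
  have hw1 : ∀ D, ∑ c, w D c = 1 := by
    intro D
    have h := Finset.prod_univ_sum (fun _ : Σ k, M k => (Finset.univ : Finset V)) (fun i x =>
      ν i.1 (ι i.1 i.2 + D i.1) x)
    rw [Fintype.piFinset_univ] at h
    simp only [w]
    rw [← h]
    exact Finset.prod_eq_one fun i _ => hν1 _ _
  have hS0 : (0 : ℝ) < ∏ k, (Fintype.card (S k) : ℝ) := Finset.prod_pos fun k _ => hcard k
  have hone : ∀ m : ∀ k, M k,
      ∑ D, ∑ c, w D c * err (fun k => (ι k (m k) + D k, c ⟨k, m k⟩)) ≤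
        (∏ k, (Fintype.card (S k) : ℝ)) * B := by
    intro m
    have h1 : ∀ D, ∑ c, w D c * err (fun k => (ι k (m k) + D k, c ⟨k, m k⟩)) =
        ∑ u : Fin K → V, (∏ k, ν k (ι k (m k) + D k) (u k)) *
          err (fun k => (ι k (m k) + D k, u k)) := by
      intro D
      exact sum_prod_comp (fun i : Σ k, M k => ν i.1 (ι i.1 i.2 + D i.1)) (fun i => hν1 _ _)
        (fun k => (⟨k, m k⟩ : Σ k, M k)) (fun k k' hk => congrArg Sigma.fst hk)
        (fun u => err (fun k => (ι k (m k) + D k, u k)))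
    simp only [h1]
    -- Averaging over `D` makes the prescribed hash of each fixed message tuple uniform, whatever
    -- `ι` is.
    have h2 := Equiv.sum_comp (Equiv.addLeft (fun k => ι k (m k))) (fun s : ∀ k, S k =>
      ∑ u : Fin K → V, (∏ k, ν k (s k) (u k)) * err (fun k => (s k, u k)))
    simp only [Equiv.coe_addLeft, Pi.add_apply] at h2
    rw [h2]
    refine le_trans (le_of_eq ?_) (mul_le_mul_of_nonneg_left hmain hS0.le)
    rw [← split.symm.sum_comp, Fintype.sum_prod_type, Finset.mul_sum]
    refine Finset.sum_congr rfl fun s _ => ?_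
    rw [Finset.mul_sum]
    refine Finset.sum_congr rfl fun u _ => ?_
    simp only [split, Equiv.coe_fn_symm_mk, ω, Finset.prod_mul_distrib, Finset.prod_inv_distrib]
    rw [← mul_assoc, ← mul_assoc, mul_inv_cancel₀ hS0.ne', one_mul]
  -- The average over shifts and codebooks meets the bound, so some choice does; otherwise all
  -- weights `w` would vanish.
  have htot : ∑ D, ∑ c, w D c * (Err D c - (∏ k, (Fintype.card (M k) : ℝ)) * B) ≤ 0 := by
    simp only [mul_sub, Finset.sum_sub_distrib, ← Finset.sum_mul, hw1]
    simp only [Err, Finset.mul_sum]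
    have h1 : ∑ D, ∑ c, ∑ m : ∀ k, M k, w D c * err (fun k => (ι k (m k) + D k, c ⟨k, m k⟩)) =
        ∑ m : ∀ k, M k, ∑ D, ∑ c, w D c * err (fun k => (ι k (m k) + D k, c ⟨k, m k⟩)) := by
      rw [Finset.sum_comm' (s := (Finset.univ : Finset (∀ k, M k)))
        (t' := (Finset.univ : Finset (∀ k, S k))) (s' := fun _ => Finset.univ) (by simp)]
      exact Finset.sum_congr rfl fun D _ => Finset.sum_comm
    rw [h1]
    have h2 := Finset.sum_le_sum (s := Finset.univ) fun m _ => hone m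
    refine sub_nonpos.2 (h2.trans (le_of_eq ?_))
    simp [Finset.card_univ, Fintype.card_pi]
    ring
  by_contra hcon
  push Not at hcon
  have hpos : ∀ D c, 0 < Err D c - (∏ k, (Fintype.card (M k) : ℝ)) * B := fun D c =>
    sub_pos.2 (hcon D fun k m => c ⟨k, m⟩)
  have hzero : ∀ D c, w D c = 0 := by
    intro D c
    have h1 : ∀ D c, 0 ≤ w D c * (Err D c - (∏ k, (Fintype.card (M k) : ℝ)) * B) := fun D c =>
      mul_nonneg (hw0 D c) (hpos D c).le
    have h2 := (Finset.sum_eq_zero_iff_of_nonneg fun D _ => Finset.sum_nonneg fun c _ => h1 D c).1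
      (le_antisymm htot (Finset.sum_nonneg fun D _ => Finset.sum_nonneg fun c _ => h1 D c)) D
      (Finset.mem_univ D)
    have h3 := (Finset.sum_eq_zero_iff_of_nonneg fun c _ => h1 D c).1 h2 c (Finset.mem_univ c)
    exact (mul_eq_zero.1 h3).resolve_right (hpos D c).ne'
  have := hw1 fun k => (hSne k).some
  simp [hzero] at this

end Finite

/-! ### Block laws and the weak law of large numbers -/

section Block

variable {F : Type*} [Fintype F] [MeasurableSpace F] [DiscreteMeasurableSpace F]
  {K : ℕ} {X : Fin K → Type*} [∀ k, MeasurableSpace (X k)] {Y : Type*} [MeasurableSpace Y]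

theorem jointLaw_apply (W : Kernel (∀ k, X k) Y) [IsMarkovKernel W] (p : Fin K → PMF F)
    (x : ∀ k, F → X k) {B : Set ((Fin K → F) × Y)} (hB : MeasurableSet B) :
    jointLaw W p x B =
      ∑ v : Fin K → F, (∏ k, p k (v k)) * W (fun k => x k (v k)) (Prod.mk v ⁻¹' B) := by
  classical
  rw [jointLaw, Measure.compProd_apply hB, lintegral_fintype]
  refine Finset.sum_congr rfl fun v _ => ?_
  rw [Measure.pi_singleton, mul_comm, Kernel.comap_apply]
  congr 1
  exact Finset.prod_congr rfl fun k _ => PMF.toMeasure_apply_singleton _ _ (measurableSet_singleton _)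

theorem pi_jointLaw_apply (W : Kernel (∀ k, X k) Y) [IsMarkovKernel W] (p : Fin K → PMF F)
    (x : ∀ k, F → X k) (n : ℕ) {B : Set (Fin n → (Fin K → F) × Y)} (hB : MeasurableSet B) :
    Measure.pi (fun _ : Fin n => jointLaw W p x) B =
      ∑ v : Fin n → Fin K → F, (∏ i, ∏ k, p k (v i k)) *
        Measure.pi (fun i => W fun k => x k (v i k)) {y | (fun i => (v i, y i)) ∈ B} := by
  classical
  have hmeas : ∀ v : Fin n → Fin K → F, Measurable fun (y : Fin n → Y) i => (v i, y i) :=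
    fun v => measurable_pi_lambda _ fun i => by fun_prop
  -- The mixture over input sequences of the product channels; it agrees with the product measure on
  -- boxes, hence everywhere.
  let ν : Measure (Fin n → (Fin K → F) × Y) := ∑ v : Fin n → Fin K → F,
    (∏ i, ∏ k, p k (v i k)) •
      (Measure.pi (fun i => W fun k => x k (v i k))).map fun y i => (v i, y i)
  have hν : ∀ {B : Set (Fin n → (Fin K → F) × Y)}, MeasurableSet B → ν B =
      ∑ v : Fin n → Fin K → F, (∏ i, ∏ k, p k (v i k)) *
        Measure.pi (fun i => W fun k => x k (v i k)) {y | (fun i => (v i, y i)) ∈ B} := by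
    intro B hB
    simp only [ν, Measure.coe_finsetSum, Finset.sum_apply, Measure.smul_apply, smul_eq_mul]
    refine Finset.sum_congr rfl fun v _ => ?_
    rw [Measure.map_apply (hmeas v) hB]
    rfl
  rw [← hν hB]
  congr 1
  refine Measure.pi_eq fun s hs => ?_
  rw [hν (MeasurableSet.univ_pi hs)]
  simp only [fun i => jointLaw_apply W p x (hs i)]
  rw [Finset.prod_univ_sum, Fintype.piFinset_univ]
  refine Finset.sum_congr rfl fun v _ => ?_
  rw [Finset.prod_mul_distrib]
  congr 1
  rw [← Measure.pi_pi]
  congr 1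

theorem pi_jointLaw_real (W : Kernel (∀ k, X k) Y) [IsMarkovKernel W] (p : Fin K → PMF F)
    (x : ∀ k, F → X k) (n : ℕ) {B : Set (Fin n → (Fin K → F) × Y)} (hB : MeasurableSet B) :
    (Measure.pi fun _ : Fin n => jointLaw W p x).real B =
      ∑ u : Fin K → Fin n → F, (∏ k, ∏ i, (p k (u k i)).toReal) *
        (Measure.pi fun i => W fun k => x k (u k i)).real
          {y | (fun i => ((fun k => u k i), y i)) ∈ B} := by
  classical
  rw [Measure.real, pi_jointLaw_apply W p x n hB, ENNReal.toReal_sum]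
  · rw [← (Equiv.piComm fun (_ : Fin K) (_ : Fin n) => F).sum_comp]
    refine Finset.sum_congr rfl fun u _ => ?_
    rw [ENNReal.toReal_mul, Measure.real, Finset.prod_comm, ENNReal.toReal_prod]
    congr 1
    exact Finset.prod_congr rfl fun k _ => ENNReal.toReal_prod _ _
  · intro v _
    refine ENNReal.mul_ne_top ?_ (measure_ne_top _ _)
    exact ENNReal.prod_ne_top fun i _ => ENNReal.prod_ne_top fun k _ => PMF.apply_ne_top _ _

end Block

/-- Weak law of large numbers, upper tail. -/
theorem tendsto_pi_sum_ge {Ω : Type*} [MeasurableSpace Ω] (μ : Measure Ω) [IsProbabilityMeasure μ]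
    (Z : Ω → ℝ) (hZ : MemLp Z 2 μ) (θ : ℝ) (hθ : ∫ ω, Z ω ∂μ < θ) :
    Tendsto (fun n : ℕ => (Measure.pi fun _ : Fin n => μ).real {ω | n * θ ≤ ∑ i, Z (ω i)})
      atTop (𝓝 0) := by
  set a : ℝ := θ - ∫ ω, Z ω ∂μ with ha
  have ha0 : 0 < a := sub_pos.2 hθ
  have hbound : ∀ n : ℕ, 0 < n → (Measure.pi fun _ : Fin n => μ).real {ω | n * θ ≤ ∑ i, Z (ω i)} ≤
      (variance Z μ / a ^ 2) / n := by
    intro n hn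
    have hn' : (0 : ℝ) < n := by exact_mod_cast hn
    set μn := Measure.pi fun _ : Fin n => μ
    set T : (Fin n → Ω) → ℝ := ∑ i, fun ω => Z (ω i) with hT
    have hcoord : ∀ i : Fin n, MemLp (fun ω : Fin n → Ω => Z (ω i)) 2 μn := fun i =>
      hZ.comp_measurePreserving (measurePreserving_eval (fun _ => μ) i)
    have hTL : MemLp T 2 μn := memLp_finsetSum' _ fun i _ => hcoord i
    have hTE : ∫ ω, T ω ∂μn = n * ∫ ω, Z ω ∂μ := by
      simp only [hT, Finset.sum_apply]
      rw [integral_finsetSum _ fun i _ => (hcoord i).integrable one_le_two]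
      have : ∀ i : Fin n, ∫ ω, Z (ω i) ∂μn = ∫ ω, Z ω ∂μ := fun i =>
        integral_comp_eval (μ := fun _ => μ) (i := i) (f := Z) hZ.aestronglyMeasurable
      simp [this]
    have hTV : variance T μn = n * variance Z μ := by
      rw [hT, variance_sum_pi (μ := fun _ : Fin n => μ) (X := fun _ => Z) fun _ => hZ]
      simp
    have hna : 0 < n * a := mul_pos hn' ha0
    have hch := meas_ge_le_variance_div_sq hTL hna
    have hsub : {ω : Fin n → Ω | n * θ ≤ ∑ i, Z (ω i)} ⊆ {ω | n * a ≤ |T ω - μn[T]|} := by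
      intro ω hω
      simp only [Set.mem_ofPred_eq] at hω ⊢
      rw [hTE]
      refine le_trans ?_ (le_abs_self _)
      simp only [hT, Finset.sum_apply, ha]
      linarith
    have h1 : μn.real {ω | n * θ ≤ ∑ i, Z (ω i)} ≤ variance T μn / (n * a) ^ 2 := by
      refine (measureReal_mono hsub).trans ?_
      exact ENNReal.toReal_le_of_le_ofReal (div_nonneg (variance_nonneg _ _) (sq_nonneg _)) hch
    refine h1.trans (le_of_eq ?_)
    rw [hTV]
    field_simp
  refine tendsto_of_tendsto_of_tendsto_of_le_of_le' tendsto_const_nhds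
    (tendsto_const_div_atTop_nhds_zero_nat (variance Z μ / a ^ 2)) ?_ ?_
  · exact Eventually.of_forall fun n => measureReal_nonneg
  · filter_upwards [eventually_gt_atTop 0] with n hn using hbound n hn

/-! ### Typicality decoding of a pair from its hashes -/

section Decoding

open scoped Classical

set_option linter.unusedSectionVars false

variable {F : Type*} [Field F] [Fintype F] {K : ℕ} {Y : Type*} [MeasurableSpace Y]

/-- The linear combinations of sequences `u k` with coefficients the rows of `a`. -/
def comb {n : ℕ} (a : Fin 2 → Fin K → F) (u : Fin K → Fin n → F) : Fin 2 → Fin n → F :=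
  fun l i => ∑ k, a l k * u k i

/-- The output sequences that are jointly typical with `w` for the family `g` of
conditional pmf's. -/
def typicalSet (g : (Fin 2 → F) → (Fin 2 → F) → Y → ℝ) (θ : (Fin 2 → F) → ℝ) {n : ℕ}
    (w : Fin 2 → Fin n → F) : Set (Fin n → Y) :=
  {y | ∀ b, Real.exp (-(n * θ b)) ≤ ∏ i, g b (fun l => w l i) (y i)}

theorem measurableSet_typicalSet {g : (Fin 2 → F) → (Fin 2 → F) → Y → ℝ}
    (hg : ∀ b w, Measurable (g b w)) (θ : (Fin 2 → F) → ℝ) {n : ℕ} (w : Fin 2 → Fin n → F) :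
    MeasurableSet (typicalSet g θ w) := by
  have : typicalSet g θ w =
      ⋂ b, {y | Real.exp (-(n * θ b)) ≤ ∏ i, g b (fun l => w l i) (y i)} := by
    ext y
    simp [typicalSet]
  rw [this]
  refine MeasurableSet.iInter fun b => measurableSet_le measurable_const ?_
  exact Finset.measurable_prod _ fun i _ => (hg b _).comp (measurable_pi_apply i)

/-- For a typical `w` the product of the conditional pmf's times `exp (n θ)` is at least 1. Summed
over all `w` with the prescribed combination, the product factors over positions into sums that are
at most 1. -/
theorem sum_typicalSet_le {g : (Fin 2 → F) → (Fin 2 → F) → Y → ℝ} (hg0 : ∀ b w y, 0 ≤ g b w y)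
    (hg1 : ∀ b y v, (∑ w, if b ⬝ᵥ w = v then g b w y else 0) ≤ 1) (θ : (Fin 2 → F) → ℝ) {n : ℕ}
    (b : Fin 2 → F) (v : Fin n → F) (y : Fin n → Y) :
    (∑ w : Fin 2 → Fin n → F, if (∑ l, b l • w l = v) ∧ y ∈ typicalSet g θ w
      then (1 : ℝ) else 0) ≤ Real.exp (n * θ b) := by
  have h1 : ∀ w : Fin 2 → Fin n → F, (if (∑ l, b l • w l = v) ∧ y ∈ typicalSet g θ w
      then (1 : ℝ) else 0) ≤ Real.exp (n * θ b) *
        ∏ i, (if b ⬝ᵥ (fun l => w l i) = v i then g b (fun l => w l i) (y i) else 0) := by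
    intro w
    have hnn : 0 ≤ ∏ i, (if b ⬝ᵥ (fun l => w l i) = v i then g b (fun l => w l i) (y i) else 0) :=
      Finset.prod_nonneg fun i _ => by split_ifs <;> simp [hg0]
    split_ifs with hw
    · have h2 : ∏ i, (if b ⬝ᵥ (fun l => w l i) = v i then g b (fun l => w l i) (y i) else 0) =
          ∏ i, g b (fun l => w l i) (y i) := by
        refine Finset.prod_congr rfl fun i _ => if_pos ?_
        rw [← hw.1]
        simp [dotProduct]
      rw [h2]
      have h3 := hw.2 b
      calc (1 : ℝ) = Real.exp (n * θ b) * Real.exp (-(n * θ b)) := by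
            rw [← Real.exp_add]; simp
        _ ≤ _ := mul_le_mul_of_nonneg_left h3 (Real.exp_pos _).le
    · positivity
  refine (Finset.sum_le_sum fun w _ => h1 w).trans ?_
  rw [← Finset.mul_sum]
  refine mul_le_of_le_one_right (Real.exp_pos _).le ?_
  rw [← (Equiv.piComm fun (_ : Fin n) (_ : Fin 2) => F).sum_comp]
  have h := Finset.prod_univ_sum (fun _ : Fin n => (Finset.univ : Finset (Fin 2 → F))) (fun i w =>
    if b ⬝ᵥ w = v i then g b w (y i) else 0)
  rw [Fintype.piFinset_univ] at h
  refine (h.symm.le).trans ?_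
  exact Finset.prod_le_one (fun i _ => Finset.sum_nonneg fun w _ => by split_ifs <;> simp [hg0])
    fun i _ => hg1 b (y i) (v i)

/-- The hashes, with the first `f l` rows of `Q`, of `w l` and `w' l` agree. -/
def Agree {N n : ℕ} (f : Fin 2 → ℕ) (Q : Fin N → Fin n → F) (w w' : Fin 2 → Fin n → F) : Prop :=
  ∀ l, ∀ i : Fin N, i.1 < f l → Q i ⬝ᵥ w' l = Q i ⬝ᵥ w l

/-- `τ b` bounds the collision probability of different pairs of sequences that agree in
the linear combination `b`. -/
def CollisionWeight (F : Type*) [Field F] [Fintype F] (f : Fin 2 → ℕ) (τ : (Fin 2 → F) → ℝ) :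
    Prop :=
  ∀ b, (b = 0 ∧ τ b = ((Fintype.card F : ℝ) ^ (f 0 + f 1))⁻¹) ∨
    (b 1 ≠ 0 ∧ τ b = ((Fintype.card F : ℝ) ^ f 0)⁻¹) ∨
    (b 0 ≠ 0 ∧ τ b = ((Fintype.card F : ℝ) ^ f 1)⁻¹)

theorem CollisionWeight.nonneg {f : Fin 2 → ℕ} {τ : (Fin 2 → F) → ℝ}
    (hτ : CollisionWeight F f τ) (b : Fin 2 → F) : 0 ≤ τ b := by
  rcases hτ b with h | h | h <;> rw [h.2] <;> positivity

/-- Independent differences are charged to `b = 0`. Otherwise `b` is a linear relation between them: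
if `b 1 ≠ 0`, then `δ 0 = 0` would force `δ 1 = 0`, so `δ 0 ≠ 0` and its hash alone gives the bound;
likewise with the roles exchanged. -/
theorem exists_sum_annihilate_le {N n : ℕ} {f : Fin 2 → ℕ} (hf : ∀ l, f l ≤ N)
    {τ : (Fin 2 → F) → ℝ} (hτ : CollisionWeight F f τ) {δ : Fin 2 → Fin n → F} (hδ : δ ≠ 0) :
    ∃ b : Fin 2 → F, ∑ l, b l • δ l = 0 ∧
      (∑ Q : Fin N → Fin n → F, if ∀ l, ∀ i : Fin N, i.1 < f l → Q i ⬝ᵥ δ l = 0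
        then (1 : ℝ) else 0) ≤ Fintype.card (Fin N → Fin n → F) * τ b := by
  by_cases hli : LinearIndependent F δ
  · refine ⟨0, by simp, ?_⟩
    have hτ0 : τ 0 = ((Fintype.card F : ℝ) ^ (f 0 + f 1))⁻¹ := by
      rcases hτ 0 with h | h | h
      · exact h.2
      · simp at h
      · simp at h
    have h := sum_annihilate_le f hf δ hli
    rw [Fin.sum_univ_two, ← hτ0] at h
    convert h
  · obtain ⟨b, hb, hb0⟩ := Fintype.not_linearIndependent_iff.1 hli
    have single : ∀ l, δ l ≠ 0 → (∑ Q : Fin N → Fin n → F,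
        if ∀ l, ∀ i : Fin N, i.1 < f l → Q i ⬝ᵥ δ l = 0 then (1 : ℝ) else 0) ≤
        Fintype.card (Fin N → Fin n → F) * ((Fintype.card F : ℝ) ^ f l)⁻¹ := by
      intro l hl
      have h := sum_annihilate_le (fun _ : Unit => f l) (fun _ => hf l) (fun _ : Unit => δ l)
        (linearIndependent_single hl)
      simp only [Finset.univ_unique, Finset.sum_singleton] at h
      refine le_trans (Finset.sum_le_sum fun Q _ => ?_) h
      split_ifs with h1 h2
      · exact le_rfl
      · exact absurd (fun _ => h1 l) h2
      · exact zero_le_one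
      · exact le_rfl
    refine ⟨b, hb, ?_⟩
    rw [Fin.sum_univ_two] at hb
    rcases hτ b with h | h | h
    · obtain ⟨l, hl⟩ := hb0
      simp [h.1] at hl
    · rw [h.2]
      refine single 0 fun h0 => hδ ?_
      rw [h0, smul_zero, zero_add] at hb
      have h1 := (smul_eq_zero.1 hb).resolve_left h.1
      ext l : 1
      fin_cases l <;> assumption
    · rw [h.2]
      refine single 1 fun h0 => hδ ?_
      rw [h0, smul_zero, add_zero] at hb
      have h1 := (smul_eq_zero.1 hb).resolve_left h.1
      ext l : 1
      fin_cases l <;> assumption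

theorem exists_sum_agree_le {N n : ℕ} {f : Fin 2 → ℕ} (hf : ∀ l, f l ≤ N) {τ : (Fin 2 → F) → ℝ}
    (hτ : CollisionWeight F f τ) {w w' : Fin 2 → Fin n → F} (hne : w' ≠ w) :
    ∃ b : Fin 2 → F, ∑ l, b l • w' l = ∑ l, b l • w l ∧
      (∑ Q : Fin N → Fin n → F, if Agree f Q w w' then (1 : ℝ) else 0) ≤
        Fintype.card (Fin N → Fin n → F) * τ b := by
  obtain ⟨b, hb, h⟩ := exists_sum_annihilate_le hf hτ (sub_ne_zero.2 hne)
  refine ⟨b, ?_, ?_⟩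
  · simpa [smul_sub, sub_eq_zero] using hb
  · have hagree : ∀ Q : Fin N → Fin n → F, Agree f Q w w' ↔
        ∀ l, ∀ i : Fin N, i.1 < f l → Q i ⬝ᵥ (w' - w) l = 0 := by
      intro Q
      simp [Agree, dotProduct_sub, sub_eq_zero]
    simpa only [hagree] using h

/-- The output sequences for which `w` is not the only typical pair with its hash value. -/
def confusable (g : (Fin 2 → F) → (Fin 2 → F) → Y → ℝ) (θ : (Fin 2 → F) → ℝ) {N n : ℕ}
    (f : Fin 2 → ℕ) (Q : Fin N → Fin n → F) (w : Fin 2 → Fin n → F) : Set (Fin n → Y) :=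
  {y | y ∉ typicalSet g θ w ∨ ∃ w', w' ≠ w ∧ y ∈ typicalSet g θ w' ∧ Agree f Q w w'}

/-- A union bound over wrong pairs, each charged to a relation `b` satisfied by its difference from
`w`. The output law `ρ` does not depend on `Q`, so the collision probability and the probability of
typicality multiply. -/
theorem sum_confusable_le {g : (Fin 2 → F) → (Fin 2 → F) → Y → ℝ}
    (hg : ∀ b w, Measurable (g b w)) (hg0 : ∀ b w y, 0 ≤ g b w y)
    (hg1 : ∀ b y v, (∑ w, if b ⬝ᵥ w = v then g b w y else 0) ≤ 1) (θ : (Fin 2 → F) → ℝ)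
    {N n : ℕ} {f : Fin 2 → ℕ} (hf : ∀ l, f l ≤ N) {τ : (Fin 2 → F) → ℝ}
    (hτ : CollisionWeight F f τ) (w : Fin 2 → Fin n → F) (ρ : Measure (Fin n → Y))
    [IsProbabilityMeasure ρ] :
    ∑ Q : Fin N → Fin n → F, ρ.real (confusable g θ f Q w) ≤
      Fintype.card (Fin N → Fin n → F) *
        (ρ.real (typicalSet g θ w)ᶜ + ∑ b, Real.exp (n * θ b) * τ b) := by
  have hT := fun w => measurableSet_typicalSet (n := n) hg θ w
  have h1 : ∀ Q : Fin N → Fin n → F, ρ.real (confusable g θ f Q w) ≤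
      ρ.real (typicalSet g θ w)ᶜ + ∑ w' : Fin 2 → Fin n → F,
        if w' ≠ w then (if Agree f Q w w' then 1 else 0) * ρ.real (typicalSet g θ w') else 0 := by
    intro Q
    have hsub : confusable g θ f Q w ⊆ (typicalSet g θ w)ᶜ ∪
        ⋃ w' ∈ Finset.univ.filter (fun w' => w' ≠ w ∧ Agree f Q w w'), typicalSet g θ w' := by
      rintro y (hy | ⟨w', h1, h2, h3⟩)
      · exact Or.inl hy
      · refine Or.inr ?_
        simp only [Set.mem_iUnion]
        exact ⟨w', by simp [h1, h3], h2⟩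
    refine (measureReal_mono hsub).trans ((measureReal_union_le _ _).trans ?_)
    gcongr
    refine (measureReal_biUnion_finset_le _ _).trans (le_of_eq ?_)
    rw [Finset.sum_filter]
    refine Finset.sum_congr rfl fun w' _ => ?_
    by_cases ha : w' = w <;> by_cases hb : Agree f Q w w' <;> simp [ha, hb]
  have hC : (0 : ℝ) ≤ Fintype.card (Fin N → Fin n → F) := by positivity
  have h2 : ∀ w', (∑ Q : Fin N → Fin n → F,
      if w' ≠ w then (if Agree f Q w w' then 1 else 0) * ρ.real (typicalSet g θ w') else 0) ≤
      ∑ b : Fin 2 → F, Fintype.card (Fin N → Fin n → F) * τ b *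
        (if ∑ l, b l • w' l = ∑ l, b l • w l then ρ.real (typicalSet g θ w') else 0) := by
    intro w'
    have hnn : ∀ b ∈ (Finset.univ : Finset (Fin 2 → F)),
        0 ≤ Fintype.card (Fin N → Fin n → F) * τ b *
        (if ∑ l, b l • w' l = ∑ l, b l • w l then ρ.real (typicalSet g θ w') else 0) := by
      intro b _
      refine mul_nonneg (mul_nonneg hC (hτ.nonneg b)) ?_
      split_ifs <;> simp
    by_cases hne : w' = w
    · refine le_trans (le_of_eq ?_) (Finset.sum_nonneg hnn)
      simp [hne]
    · obtain ⟨b, hb, hb'⟩ := exists_sum_agree_le hf hτ hne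
      refine le_trans ?_ (Finset.single_le_sum hnn (Finset.mem_univ b))
      simp only [ne_eq, hne, not_false_eq_true, if_true, hb]
      rw [← Finset.sum_mul]
      exact mul_le_mul_of_nonneg_right hb' measureReal_nonneg
  have h3 : ∀ b : Fin 2 → F, (∑ w' : Fin 2 → Fin n → F,
      if ∑ l, b l • w' l = ∑ l, b l • w l then ρ.real (typicalSet g θ w') else 0) ≤
        Real.exp (n * θ b) := by
    intro b
    -- Written as integrals over the output, the probabilities can be summed pointwise in `y`, where
    -- the counting bound applies.
    have h4 : ∀ w' : Fin 2 → Fin n → F,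
        (if ∑ l, b l • w' l = ∑ l, b l • w l then ρ.real (typicalSet g θ w') else 0) =
        ∫ y, (if (∑ l, b l • w' l = ∑ l, b l • w l) ∧ y ∈ typicalSet g θ w'
          then (1 : ℝ) else 0) ∂ρ := by
      intro w'
      by_cases hw : ∑ l, b l • w' l = ∑ l, b l • w l
      · simp only [hw, true_and, if_true]
        rw [← integral_indicator_one (hT w')]
        refine integral_congr_ae (Eventually.of_forall fun y => ?_)
        simp [Set.indicator_apply]
      · simp only [hw, false_and, if_false, integral_zero]
    have h5 : ∀ w' : Fin 2 → Fin n → F, Integrable (fun y =>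
        if (∑ l, b l • w' l = ∑ l, b l • w l) ∧ y ∈ typicalSet g θ w' then (1 : ℝ) else 0) ρ := by
      intro w'
      by_cases hw : ∑ l, b l • w' l = ∑ l, b l • w l
      · simp only [hw, true_and]
        refine ((integrable_const (1 : ℝ)).indicator (hT w')).congr
          (Eventually.of_forall fun y => ?_)
        simp [Set.indicator_apply]
      · simp only [hw, false_and, if_false]
        exact integrable_zero _ _ _
    simp only [h4]
    rw [← integral_finsetSum _ fun w' _ => h5 w']
    calc _ ≤ ∫ _, Real.exp (n * θ b) ∂ρ := by
          refine integral_mono (integrable_finsetSum _ fun w' _ => h5 w') (integrable_const _) ?_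
          intro y
          exact sum_typicalSet_le hg0 hg1 θ b _ y
      _ = _ := by simp
  refine (Finset.sum_le_sum fun Q _ => h1 Q).trans ?_
  rw [Finset.sum_add_distrib, Finset.sum_comm (s := (Finset.univ : Finset (Fin N → Fin n → F))),
    Finset.sum_const, Finset.card_univ, nsmul_eq_mul, mul_add]
  gcongr
  refine (Finset.sum_le_sum fun w' _ => h2 w').trans ?_
  rw [Finset.sum_comm, Finset.mul_sum]
  refine Finset.sum_le_sum fun b _ => ?_
  rw [← Finset.mul_sum, mul_assoc, mul_comm (Real.exp _)]
  gcongr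
  · exact hτ.nonneg b
  · exact h3 b

/-- A decoder that looks for a typical pair in the set `C`. -/
theorem exists_decoder [MeasurableSpace F] [DiscreteMeasurableSpace F]
    {g : (Fin 2 → F) → (Fin 2 → F) → Y → ℝ}
    (hg : ∀ b w, Measurable (g b w)) (θ : (Fin 2 → F) → ℝ) {n : ℕ}
    (C : Set (Fin 2 → Fin n → F)) :
    ∃ dec : (Fin n → Y) → Fin 2 → Fin n → F, Measurable dec ∧
      ∀ w y, w ∈ C → y ∈ typicalSet g θ w →
        (∀ w' ∈ C, y ∈ typicalSet g θ w' → w' = w) → dec y = w := by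
  -- The decoder sees `y` only through the finite pattern of which pairs are typical with it; this
  -- makes an arbitrary choice measurable.
  let sel : ((Fin 2 → Fin n → F) → Prop) → Fin 2 → Fin n → F := fun T =>
    if h : ∃ w, w ∈ C ∧ T w then h.choose else 0
  let cand : (Fin n → Y) → (Fin 2 → Fin n → F) → Prop := fun y w => y ∈ typicalSet g θ w
  have hcand : Measurable cand := measurable_pi_lambda _ fun w =>
    measurableSet_setOfPred.1 (measurableSet_typicalSet hg θ w)
  refine ⟨fun y => sel (cand y), (Measurable.of_discrete (f := sel)).comp hcand, ?_⟩
  intro w y hw hy huniq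
  have h : ∃ w, w ∈ C ∧ cand y w := ⟨w, hw, hy⟩
  simp only [sel]
  rw [dif_pos h]
  exact huniq _ h.choose_spec.1 h.choose_spec.2

end Decoding

/-! ### Codes of a fixed block length -/

section CodeExistence

open scoped Classical

set_option linter.unusedSectionVars false

variable {F : Type*} [Field F] [Fintype F]

/-- The number of hash bits of the sequence of user `k` that are fixed: those used for
decoding a linear combination in which user `k` takes part. -/
noncomputable def frozen {K : ℕ} (a : Fin 2 → Fin K → F) (f : Fin 2 → ℕ) (k : Fin K) : ℕ :=
  Finset.univ.sup fun l => if a l k ≠ 0 then f l else 0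

theorem le_frozen {K : ℕ} {a : Fin 2 → Fin K → F} (f : Fin 2 → ℕ) {k : Fin K} {l : Fin 2}
    (h : a l k ≠ 0) : f l ≤ frozen a f k := by
  have := Finset.le_sup (f := fun l => if a l k ≠ 0 then f l else 0) (Finset.mem_univ l)
  simpa [h, frozen] using this

theorem frozen_eq_zero {K : ℕ} {a : Fin 2 → Fin K → F} (f : Fin 2 → ℕ) {k : Fin K}
    (h : ∀ l, a l k = 0) : frozen a f k = 0 := by
  simp [frozen, h]

/-- The hash of a sequence given by the first `r` rows of a matrix. -/
def rowHash {N n : ℕ} (Q : Fin N → Fin n → F) {r : ℕ} (hr : r ≤ N) (u : Fin n → F) : Fin r → F :=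
  fun j => Q (Fin.castLE hr j) ⬝ᵥ u

/-- Universality, as required by `leftover_hash`: by linearity a collision means that the rows
annihilate the nonzero vector `u - u'`. -/
theorem sum_rowHash_eq_le {N n r : ℕ} (hr : r ≤ N) {u u' : Fin n → F} (hne : u ≠ u') :
    (∑ Q : Fin N → Fin n → F, if rowHash Q hr u = rowHash Q hr u' then (1 : ℝ) else 0) ≤
      Fintype.card (Fin N → Fin n → F) * (Fintype.card (Fin r → F) : ℝ)⁻¹ := by
  have h := sum_annihilate_le (fun _ : Unit => r) (fun _ => hr) (fun _ : Unit => u - u')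
    (linearIndependent_single (sub_ne_zero.2 hne))
  simp only [Finset.univ_unique, Finset.sum_singleton] at h
  have hcard : (Fintype.card (Fin r → F) : ℝ) = (Fintype.card F : ℝ) ^ r := by simp
  rw [hcard]
  refine le_trans (Finset.sum_le_sum fun Q _ => ?_) h
  split_ifs with h1 h2
  · exact le_rfl
  · refine absurd (fun _ i hi => ?_) h2
    have := congrFun h1 ⟨i, hi⟩
    rw [dotProduct_sub, sub_eq_zero]
    exact this
  · exact zero_le_one
  · exact le_rfl

theorem dotProduct_comb {K n : ℕ} (a : Fin 2 → Fin K → F) (u : Fin K → Fin n → F) (r : Fin n → F)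
    (l : Fin 2) : r ⬝ᵥ comb a u l = ∑ k, a l k * (r ⬝ᵥ u k) := by
  have : comb a u l = ∑ k, a l k • u k := by
    ext i
    simp [comb]
  rw [this, dotProduct_sum]
  simp [dotProduct_smul]

/-- The average probability of error, over random linear hash functions, for independent
sequences with independent symbols. -/
theorem sum_pi_confusable_le [MeasurableSpace F] [DiscreteMeasurableSpace F]
    {K : ℕ} {X : Fin K → Type*} [∀ k, MeasurableSpace (X k)]
    {Y : Type*} [MeasurableSpace Y] (W : Kernel (∀ k, X k) Y) [IsMarkovKernel W]
    (p : Fin K → PMF F) (x : ∀ k, F → X k) (a : Fin 2 → Fin K → F)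
    {g : (Fin 2 → F) → (Fin 2 → F) → Y → ℝ}
    (hg : ∀ b w, Measurable (g b w)) (hg0 : ∀ b w y, 0 ≤ g b w y)
    (hg1 : ∀ b y v, (∑ w, if b ⬝ᵥ w = v then g b w y else 0) ≤ 1) (θ : (Fin 2 → F) → ℝ)
    {N n : ℕ} {f : Fin 2 → ℕ} (hf : ∀ l, f l ≤ N) {τ : (Fin 2 → F) → ℝ}
    (hτ : CollisionWeight F f τ) :
    ∑ Q : Fin N → Fin n → F, ∑ u : Fin K → Fin n → F, (∏ k, ∏ i, (p k (u k i)).toReal) *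
        (Measure.pi fun i => W fun k => x k (u k i)).real (confusable g θ f Q (comb a u)) ≤
      Fintype.card (Fin N → Fin n → F) *
        ((Measure.pi fun _ : Fin n => jointLaw W p x).real
          {ω | (fun i => (ω i).2) ∉ typicalSet g θ (comb a fun k i => (ω i).1 k)} +
        ∑ b, Real.exp (n * θ b) * τ b) := by
  have hB : MeasurableSet {ω : Fin n → (Fin K → F) × Y |
      (fun i => (ω i).2) ∉ typicalSet g θ (comb a fun k i => (ω i).1 k)} := by
    have : {ω : Fin n → (Fin K → F) × Y |
        (fun i => (ω i).2) ∉ typicalSet g θ (comb a fun k i => (ω i).1 k)} =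
        ⋃ u : Fin K → Fin n → F, {ω | (fun k i => (ω i).1 k) = u} ∩
          (fun ω i => (ω i).2) ⁻¹' (typicalSet g θ (comb a u))ᶜ := by
      ext ω
      simp
    rw [this]
    refine MeasurableSet.iUnion fun u => MeasurableSet.inter ?_ ?_
    · have hm : Measurable fun (ω : Fin n → (Fin K → F) × Y) (k : Fin K) (i : Fin n) =>
          (ω i).1 k := by fun_prop
      exact hm (measurableSet_singleton u)
    · have hm : Measurable fun (ω : Fin n → (Fin K → F) × Y) (i : Fin n) => (ω i).2 := by fun_prop
      exact hm (measurableSet_typicalSet hg θ _).compl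
  rw [pi_jointLaw_real W p x n hB, Finset.sum_comm]
  have hP1 : ∑ u : Fin K → Fin n → F, ∏ k, ∏ i, (p k (u k i)).toReal = 1 := by
    have h := pi_jointLaw_real W p x n (B := Set.univ) MeasurableSet.univ
    simpa using h.symm
  calc _ ≤ ∑ u : Fin K → Fin n → F, (∏ k, ∏ i, (p k (u k i)).toReal) *
        (Fintype.card (Fin N → Fin n → F) *
        ((Measure.pi fun i => W fun k => x k (u k i)).real (typicalSet g θ (comb a u))ᶜ +
          ∑ b, Real.exp (n * θ b) * τ b)) := by
        refine Finset.sum_le_sum fun u _ => ?_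
        rw [← Finset.mul_sum]
        refine mul_le_mul_of_nonneg_left ?_ (Finset.prod_nonneg fun k _ =>
          Finset.prod_nonneg fun i _ => ENNReal.toReal_nonneg)
        exact sum_confusable_le hg hg0 hg1 θ hf hτ _ _
    _ = ∑ u : Fin K → Fin n → F, (Fintype.card (Fin N → Fin n → F) *
          ((∏ k, ∏ i, (p k (u k i)).toReal) *
          (Measure.pi fun i => W fun k => x k (u k i)).real (typicalSet g θ (comb a u))ᶜ) +
        (∏ k, ∏ i, (p k (u k i)).toReal) * (Fintype.card (Fin N → Fin n → F) *
          ∑ b, Real.exp (n * θ b) * τ b)) := Finset.sum_congr rfl fun u _ => by ring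
    _ = _ := by
        rw [Finset.sum_add_distrib, ← Finset.sum_mul, hP1, ← Finset.mul_sum, one_mul, mul_add]
        rfl

theorem exists_add_le {Θ : Type*} [Fintype Θ] [Nonempty Θ] {f g : Θ → ℝ} {a b : ℝ}
    (hf : ∑ i, f i ≤ Fintype.card Θ * a) (hg : ∑ i, g i ≤ Fintype.card Θ * b) :
    ∃ i, f i + g i ≤ a + b := by
  obtain ⟨i, -, hi⟩ := Finset.exists_le_of_sum_le (s := Finset.univ) (f := fun i => f i + g i)
    (g := fun _ => a + b) Finset.univ_nonempty (by
      rw [Finset.sum_add_distrib, Finset.sum_const, Finset.card_univ, nsmul_eq_mul, mul_add]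
      exact add_le_add hf hg)
  exact ⟨i, hi⟩

/-- Existence of codes of a given block length. -/
theorem exists_code_le [MeasurableSpace F] [DiscreteMeasurableSpace F]
    {K : ℕ} {X : Fin K → Type*} [∀ k, MeasurableSpace (X k)]
    {Y : Type*} [MeasurableSpace Y] (W : Kernel (∀ k, X k) Y) [IsMarkovKernel W]
    (p : Fin K → PMF F) (x : ∀ k, F → X k) (a : Fin 2 → Fin K → F)
    {g : (Fin 2 → F) → (Fin 2 → F) → Y → ℝ}
    (hg : ∀ b w, Measurable (g b w)) (hg0 : ∀ b w y, 0 ≤ g b w y)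
    (hg1 : ∀ b y v, (∑ w, if b ⬝ᵥ w = v then g b w y else 0) ≤ 1) (θ : (Fin 2 → F) → ℝ)
    {n : ℕ} {f : Fin 2 → ℕ} {τ : (Fin 2 → F) → ℝ} (hτ : CollisionWeight F f τ)
    (s : Fin K → ℕ) (hs : ∀ k, (∀ l, a l k = 0) → s k = 0) (M : Fin K → ℕ)
    (hM : ∀ k, (∃ l, a l k ≠ 0) → M k ≤ Fintype.card F ^ s k)
    (A : Fin K → (Fin n → F) → Prop) [∀ k, DecidablePred (A k)] (β : Fin K → ℝ) (hβ : ∀ k, 0 ≤ β k)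
    (hA : ∀ k u, A k u → ∏ i, (p k (u i)).toReal ≤ β k) :
    ∃ (c : ∀ k, Fin (M k) → Fin n → F) (G : ∀ k, Set (Fin (M k)))
      (dec : (Fin n → Y) → Fin 2 → Fin n → F), Measurable dec ∧
      (∀ k, (∃ l, a l k ≠ 0) → Set.InjOn (c k) (G k)) ∧
      (∀ k, ∀ m ∈ G k, ∀ i, p k (c k m i) ≠ 0) ∧
      (∑ m : ∀ k, Fin (M k), if ∀ k, m k ∈ G k then
        (Measure.pi fun i => W fun k => x k (c k (m k) i)).real
          {y | dec y ≠ comb a fun k => c k (m k)} else 1) ≤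
      (∏ k, (M k : ℝ)) * ((Measure.pi fun _ : Fin n => jointLaw W p x).real
          {ω | (fun i => (ω i).2) ∉ typicalSet g θ (comb a fun k i => (ω i).1 k)} +
        ∑ b, Real.exp (n * θ b) * τ b +
        ∑ k, if ∃ l, a l k ≠ 0 then 2 * (∑ u, if A k u then 0 else ∏ i, (p k (u i)).toReal) +
          √((Fintype.card F : ℝ) ^ (frozen a f k + s k) * β k) else 0) := by
  let r : Fin K → ℕ := fun k => frozen a f k + s k
  -- Any number of rows dominating all `r k` and `f l` would do.
  let N : ℕ := ∑ k, r k + (f 0 + f 1)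
  have hr : ∀ k, r k ≤ N := fun k =>
    (Finset.single_le_sum (f := r) (fun k _ => Nat.zero_le _) (Finset.mem_univ k)).trans
      (Nat.le_add_right _ _)
  have hf : ∀ l, f l ≤ N := by
    intro l
    fin_cases l <;> simp only [N] <;> grind
  let P : Fin K → (Fin n → F) → ℝ := fun k u => ∏ i, (p k (u i)).toReal
  have hP0 : ∀ k u, 0 ≤ P k u := fun k u => Finset.prod_nonneg fun i _ => ENNReal.toReal_nonneg
  have hP1 : ∀ k, ∑ u, P k u = 1 := by
    intro k
    have h := Finset.prod_univ_sum (fun _ : Fin n => (Finset.univ : Finset F)) (fun _ v =>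
      (p k v).toReal)
    rw [Fintype.piFinset_univ] at h
    simp only [P]
    rw [← h]
    refine Finset.prod_eq_one fun i _ => ?_
    rw [← ENNReal.toReal_sum fun v _ => PMF.apply_ne_top _ _, ← tsum_fintype (L := .unconditional _), PMF.tsum_coe,
      ENNReal.toReal_one]
  let Δ : (Fin N → Fin n → F) → Fin K → ℝ := fun Q k => ∑ t : Fin (r k) → F,
    |(Fintype.card (Fin (r k) → F) : ℝ)⁻¹ - ∑ u, if rowHash Q (hr k) u = t then P k u else 0|
  have hΔ : ∀ k, ∑ Q, Δ Q k ≤ Fintype.card (Fin N → Fin n → F) *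
      (if ∃ l, a l k ≠ 0 then 2 * (∑ u, if A k u then 0 else P k u) +
          √((Fintype.card F : ℝ) ^ (frozen a f k + s k) * β k) else 0) := by
    intro k
    split_ifs with hk
    · have h := leftover_hash (fun Q => rowHash Q (hr k)) (P k) (hP0 k) (hP1 k)
        (fun u u' hne => sum_rowHash_eq_le (hr k) hne) (β k) (hβ k) (A k) (hA k)
      have hc : (Fintype.card (Fin (r k) → F) : ℝ) =
          (Fintype.card F : ℝ) ^ (frozen a f k + s k) := by simp [r]
      rw [← hc]
      exact h
    · push Not at hk
      -- A user outside both combinations has an empty hash, which is exactly uniform and costs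
      -- nothing.
      have hrk : r k = 0 := by simp [r, frozen_eq_zero f hk, hs k hk]
      have : IsEmpty (Fin (r k)) := by rw [hrk]; infer_instance
      rw [mul_zero]
      refine le_of_eq (Finset.sum_eq_zero fun Q _ => Finset.sum_eq_zero fun t _ => ?_)
      have h1 : ∀ u, rowHash Q (hr k) u = t := fun u => Subsingleton.elim _ _
      simp [h1, hP1]
  have hΔ' : ∑ Q, ∑ k, Δ Q k ≤ Fintype.card (Fin N → Fin n → F) * ∑ k,
      (if ∃ l, a l k ≠ 0 then 2 * (∑ u, if A k u then 0 else P k u) +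
          √((Fintype.card F : ℝ) ^ (frozen a f k + s k) * β k) else 0) := by
    rw [Finset.sum_comm, Finset.mul_sum]
    exact Finset.sum_le_sum fun k _ => hΔ k
  obtain ⟨Q, hQ⟩ := exists_add_le (sum_pi_confusable_le W p x a hg hg0 hg1 θ hf hτ) hΔ'
  have hemb : ∀ k, ∃ e : Fin (M k) → Fin (s k) → F, (∃ l, a l k ≠ 0) → Function.Injective e := by
    intro k
    by_cases hk : ∃ l, a l k ≠ 0
    · have : Fintype.card (Fin (M k)) ≤ Fintype.card (Fin (s k) → F) := by
        simpa using hM k hk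
      obtain ⟨e⟩ := Function.Embedding.nonempty_of_card_le this
      exact ⟨e, fun _ => e.injective⟩
    · exact ⟨fun _ => 0, fun h => absurd h hk⟩
  choose emb hemb using hemb
  -- Zeros in the frozen rows: there the hash of the codeword is the shift alone, independent of the
  -- message.
  let ι : ∀ k, Fin (M k) → Fin (r k) → F := fun k m =>
    Fin.append (0 : Fin (frozen a f k) → F) (emb k m)
  obtain ⟨D, c, hc⟩ := exists_codebook (fun k => rowHash Q (hr k)) P hP0 hP1 ι
    (fun u => (Measure.pi fun i => W fun k => x k (u k i)).real (confusable g θ f Q (comb a u)))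
    (fun _ => measureReal_nonneg) (fun _ => measureReal_le_one)
  -- The hash that linearity forces on the `l`-th combination, in the rows below `f l`; it depends
  -- only on the shifts, so the decoder may use it.
  let t : Fin 2 → Fin N → F := fun l i =>
    ∑ k, a l k * if h : i.1 < r k then D k ⟨i, h⟩ else 0
  obtain ⟨dec, hdec, hdec'⟩ := exists_decoder hg θ (n := n)
    {w | ∀ l, ∀ i : Fin N, i.1 < f l → Q i ⬝ᵥ w l = t l i}
  refine ⟨c, fun k => {m | rowHash Q (hr k) (c k m) = ι k m + D k ∧ 0 < P k (c k m)}, dec, hdec,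
    ?_, ?_, ?_⟩
  · intro k hk m hm m' hm' heq
    have h1 : ι k m + D k = ι k m' + D k := by rw [← hm.1, ← hm'.1, heq]
    have h2 : ι k m = ι k m' := add_right_cancel h1
    refine hemb k hk (funext fun j => ?_)
    have h3 := congrFun h2 (Fin.natAdd (frozen a f k) j)
    simpa [ι, Fin.append_right] using h3
  · intro k m hm i hi
    have h1 := hm.2
    have h2 : P k (c k m) = 0 := Finset.prod_eq_zero (Finset.mem_univ i) (by simp [hi])
    exact h1.ne' h2
  · have hcard : (∏ k, (M k : ℝ)) = ∏ k, (Fintype.card (Fin (M k)) : ℝ) := by simp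
    rw [hcard]
    have hM0 : (0 : ℝ) ≤ ∏ k, (Fintype.card (Fin (M k)) : ℝ) := by positivity
    refine le_trans (le_trans (Finset.sum_le_sum fun m _ => ?_) hc)
      (mul_le_mul_of_nonneg_left hQ hM0)
    simp only [Set.mem_ofPred_eq]
    split_ifs with hm
    · refine measureReal_mono fun y hy => ?_
      by_contra hcon
      simp only [confusable, Set.mem_ofPred_eq, not_or, not_not, not_exists, not_and] at hcon
      have hmem : ∀ l, ∀ i : Fin N, i.1 < f l →
          Q i ⬝ᵥ comb a (fun k => c k (m k)) l = t l i := by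
        intro l i hi
        rw [dotProduct_comb]
        refine Finset.sum_congr rfl fun k _ => ?_
        by_cases hk : a l k = 0
        · simp [hk]
        · have hif : i.1 < frozen a f k := hi.trans_le (le_frozen f hk)
          have hir : i.1 < r k := hif.trans_le (Nat.le_add_right _ _)
          rw [dif_pos hir]
          congr 1
          have h1 := congrFun (hm k).1 ⟨i, hir⟩
          have h2 : ι k (m k) ⟨i, hir⟩ = 0 :=
            Fin.append_left (0 : Fin (frozen a f k) → F) (emb k (m k)) ⟨i, hif⟩
          rw [Pi.add_apply, h2, zero_add] at h1
          exact h1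
      refine hy (hdec' _ y hmem hcon.1 fun w' hw' hy' => ?_)
      by_contra hne
      refine hcon.2 w' hne hy' fun l i hi => ?_
      rw [hw' l i hi, hmem l i hi]
    · exact le_rfl

end CodeExistence

/-! ### Exponents of hash lengths and message numbers; atypical inputs -/

section Asymptotics

open scoped Classical

theorem tendsto_exp_neg_mul {c : ℝ} (hc : c < 0) :
    Tendsto (fun n : ℕ => Real.exp (n * c)) atTop (𝓝 0) := by
  refine Real.tendsto_exp_atBot.comp ?_
  exact (tendsto_natCast_atTop_atTop (R := ℝ)).atTop_mul_const_of_neg hc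

/-- The number of rows of hash bits corresponding to the rate `φ`. -/
noncomputable def numRows (q n : ℕ) (φ : ℝ) : ℕ := ⌈n * φ / Real.log q⌉₊

theorem exp_le_pow_numRows {q : ℕ} (hq : 1 < q) (n : ℕ) (φ : ℝ) :
    Real.exp (n * φ) ≤ (q : ℝ) ^ numRows q n φ := by
  have hlog : 0 < Real.log q := Real.log_pos (by exact_mod_cast hq)
  have hq0 : (0 : ℝ) < q := by positivity
  rw [← Real.exp_log (pow_pos hq0 _), Real.log_pow]
  refine Real.exp_le_exp.2 ?_
  have := Nat.le_ceil (n * φ / Real.log q)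
  rwa [div_le_iff₀ hlog] at this

theorem pow_numRows_le {q : ℕ} (hq : 1 < q) (n : ℕ) {φ : ℝ} (hφ : 0 ≤ φ) :
    (q : ℝ) ^ numRows q n φ ≤ q * Real.exp (n * φ) := by
  have hlog : 0 < Real.log q := Real.log_pos (by exact_mod_cast hq)
  have hq0 : (0 : ℝ) < q := by positivity
  have h1 : (numRows q n φ : ℝ) ≤ n * φ / Real.log q + 1 :=
    (Nat.ceil_lt_add_one (by positivity)).le
  rw [← Real.exp_log (pow_pos hq0 _), Real.log_pow]
  nth_rewrite 2 [← Real.exp_log hq0]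
  rw [← Real.exp_add]
  refine Real.exp_le_exp.2 ?_
  calc _ ≤ (n * φ / Real.log q + 1) * Real.log q := mul_le_mul_of_nonneg_right h1 hlog.le
    _ = _ := by field_simp; ring

theorem one_le_numMsgs (n : ℕ) (r : ℝ) : 1 ≤ numMsgs n r :=
  Nat.one_le_ceil_iff.2 (by positivity)

/-- Rounding is harmless: the ceiling in `numMsgs` costs a factor 2, the rounded-up logarithm a
factor `q`. -/
theorem pow_clog_numMsgs_le {q : ℕ} (hq : 1 < q) (n : ℕ) {r : ℝ} (hr : 0 ≤ r) :
    (q : ℝ) ^ Nat.clog q (numMsgs n r) ≤ 2 * q * Real.exp (n * (r * Real.log 2)) := by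
  have hq1 : (1 : ℝ) ≤ q := by exact_mod_cast hq.le
  have hexp : (2 : ℝ) ^ ((n : ℝ) * r) = Real.exp (n * (r * Real.log 2)) := by
    rw [Real.rpow_def_of_pos two_pos]
    congr 1
    ring
  have hexp1 : 1 ≤ Real.exp (n * (r * Real.log 2)) := by
    have := Real.log_nonneg (one_le_two (α := ℝ))
    exact Real.one_le_exp (by positivity)
  have hM : (numMsgs n r : ℝ) ≤ 2 * Real.exp (n * (r * Real.log 2)) := by
    have := (Nat.ceil_lt_add_one (a := (2 : ℝ) ^ ((n : ℝ) * r)) (by positivity)).le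
    rw [hexp] at this
    simp only [numMsgs, hexp]
    linarith
  rcases (one_le_numMsgs n r).eq_or_lt with h1 | h1
  · rw [← h1]
    simp only [Nat.clog_one_right, pow_zero]
    nlinarith
  · have h2 := Nat.pow_pred_clog_lt_self hq h1
    have h3 : 0 < Nat.clog q (numMsgs n r) := Nat.clog_pos hq h1
    have h4 : q ^ Nat.clog q (numMsgs n r) = q ^ (Nat.clog q (numMsgs n r)).pred * q := by
      rw [← pow_succ, ← Nat.succ_eq_add_one, Nat.succ_pred h3.ne']
    have h5 : (q : ℝ) ^ (Nat.clog q (numMsgs n r)).pred ≤ numMsgs n r := by exact_mod_cast h2.le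
    have h6 : (q : ℝ) ^ Nat.clog q (numMsgs n r) =
        (q : ℝ) ^ (Nat.clog q (numMsgs n r)).pred * q := by exact_mod_cast h4
    rw [h6]
    nlinarith

theorem pow_frozen_le {F : Type*} [Field F] [Fintype F] {K : ℕ} (a : Fin 2 → Fin K → F) (n : ℕ)
    {φ : Fin 2 → ℝ} (hφ : ∀ l, 0 ≤ φ l) {k : Fin K} (hk : ∃ l, a l k ≠ 0) {κ : ℝ}
    (hκ : ∀ l, a l k ≠ 0 → φ l ≤ κ) :
    (Fintype.card F : ℝ) ^ frozen a (fun l => numRows (Fintype.card F) n (φ l)) k ≤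
      Fintype.card F * Real.exp (n * κ) := by
  have hq : 1 < Fintype.card F := Fintype.one_lt_card
  have hq1 : (1 : ℝ) ≤ Fintype.card F := by exact_mod_cast hq.le
  have hκ0 : 0 ≤ κ := by
    obtain ⟨l, hl⟩ := hk
    exact (hφ l).trans (hκ l hl)
  obtain ⟨l, -, hl⟩ := Finset.exists_mem_eq_sup (Finset.univ : Finset (Fin 2))
    Finset.univ_nonempty
    (fun l => if a l k ≠ 0 then numRows (Fintype.card F) n (φ l) else 0)
  rw [frozen, hl]
  split_ifs with h
  · refine (pow_numRows_le hq n (hφ l)).trans ?_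
    gcongr
    exact hκ l h
  · have : 1 ≤ Real.exp (n * κ) := Real.one_le_exp (by positivity)
    rw [pow_zero]
    nlinarith

/-- The weak law for the information density of an i.i.d. sequence with law `p`. -/
theorem tendsto_sum_atypical {F : Type*} [Fintype F] (p : PMF F) {η : ℝ}
    (hη : η < ∑ v, Real.negMulLog (p v).toReal) :
    Tendsto (fun n : ℕ => ∑ u : Fin n → F,
      if ∏ i, (p (u i)).toReal ≤ Real.exp (-(n * η)) then 0 else ∏ i, (p (u i)).toReal)
      atTop (𝓝 0) := by
  let _ : MeasurableSpace F := ⊤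
  have : DiscreteMeasurableSpace F := ⟨fun _ => trivial⟩
  have hint : ∫ v, Real.log (p v).toReal ∂p.toMeasure < -η := by
    rw [integral_fintype (Integrable.of_finite)]
    have : ∀ v, p.toMeasure.real {v} • Real.log (p v).toReal = -Real.negMulLog (p v).toReal := by
      intro v
      rw [Measure.real, PMF.toMeasure_apply_singleton _ _ (measurableSet_singleton v)]
      simp [Real.negMulLog]
    simp only [this, Finset.sum_neg_distrib]
    linarith
  have hL2 : MemLp (fun v => Real.log (p v).toReal) 2 p.toMeasure := MemLp.of_discrete
  refine squeeze_zero (fun n => Finset.sum_nonneg fun u _ => ?_) (fun n => ?_)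
    (tendsto_pi_sum_ge p.toMeasure _ hL2 _ hint)
  · split_ifs
    · exact le_rfl
    · exact Finset.prod_nonneg fun i _ => ENNReal.toReal_nonneg
  · have h1 : ∀ u : Fin n → F, (Measure.pi fun _ : Fin n => p.toMeasure).real {u} =
        ∏ i, (p (u i)).toReal := by
      intro u
      rw [Measure.real, Measure.pi_singleton, ENNReal.toReal_prod]
      exact Finset.prod_congr rfl fun i _ => by
        rw [PMF.toMeasure_apply_singleton _ _ (measurableSet_singleton _)]
    have h2 : (Measure.pi fun _ : Fin n => p.toMeasure).real
        {ω : Fin n → F | n * -η ≤ ∑ i, Real.log (p (ω i)).toReal} =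
        ∑ u : Fin n → F, if n * -η ≤ ∑ i, Real.log (p (u i)).toReal
          then ∏ i, (p (u i)).toReal else 0 := by
      rw [← Finset.sum_filter]
      simp only [← h1]
      rw [sum_measureReal_singleton]
      congr 1
      ext u
      simp
    rw [h2]
    refine Finset.sum_le_sum fun u _ => ?_
    have hnn : 0 ≤ ∏ i, (p (u i)).toReal := Finset.prod_nonneg fun i _ => ENNReal.toReal_nonneg
    by_cases hu : ∏ i, (p (u i)).toReal ≤ Real.exp (-(n * η))
    · rw [if_pos hu]
      split_ifs
      · exact hnn
      · exact le_rfl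
    · rw [if_neg hu, if_pos]
      push Not at hu
      have hpos : 0 < ∏ i, (p (u i)).toReal := (Real.exp_pos _).trans hu
      have h3 := Real.log_le_log (Real.exp_pos _) hu.le
      rw [Real.log_exp, Real.log_prod fun i hi => (Finset.prod_ne_zero_iff.1 hpos.ne') i hi] at h3
      linarith

end Asymptotics

/-! ### Reliable codes over a finite field -/

section Asymptotics

open scoped Classical

set_option linter.unusedSectionVars false

variable {F : Type*} [Field F] [Fintype F] [MeasurableSpace F] [DiscreteMeasurableSpace F]
  {K : ℕ} {X : Fin K → Type*} [∀ k, MeasurableSpace (X k)] {Y : Type*} [MeasurableSpace Y]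
  (W : Kernel (∀ k, X k) Y) [IsMarkovKernel W] (p : Fin K → PMF F) (x : ∀ k, F → X k)
  (a : Fin 2 → Fin K → F)

/-- Sequences of linear combinations and outputs are jointly typical with high probability. -/
theorem tendsto_not_mem_typicalSet {g : (Fin 2 → F) → (Fin 2 → F) → Y → ℝ}
    (hpos : ∀ b, ∀ᵐ ω ∂jointLaw W p x, 0 < g b (fun l => ∑ k, a l k * ω.1 k) ω.2)
    (hL2 : ∀ b, MemLp (fun ω : (Fin K → F) × Y =>
      -Real.log (g b (fun l => ∑ k, a l k * ω.1 k) ω.2)) 2 (jointLaw W p x))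
    {θ : (Fin 2 → F) → ℝ}
    (hθ : ∀ b, ∫ ω, -Real.log (g b (fun l => ∑ k, a l k * ω.1 k) ω.2) ∂jointLaw W p x < θ b) :
    Tendsto (fun n : ℕ => (Measure.pi fun _ : Fin n => jointLaw W p x).real
      {ω | (fun i => (ω i).2) ∉ typicalSet g θ (comb a fun k i => (ω i).1 k)}) atTop (𝓝 0) := by
  let Z : (Fin 2 → F) → (Fin K → F) × Y → ℝ := fun b ω =>
    -Real.log (g b (fun l => ∑ k, a l k * ω.1 k) ω.2)
  have hlim : Tendsto (fun n : ℕ => ∑ b, (Measure.pi fun _ : Fin n => jointLaw W p x).real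
      {ω | n * θ b ≤ ∑ i, Z b (ω i)}) atTop (𝓝 0) := by
    rw [← Finset.sum_const_zero (s := (Finset.univ : Finset (Fin 2 → F)))]
    exact tendsto_finsetSum _ fun b _ => tendsto_pi_sum_ge _ _ (hL2 b) _ (hθ b)
  refine squeeze_zero (fun n => measureReal_nonneg) (fun n => ?_) hlim
  set μn := Measure.pi fun _ : Fin n => jointLaw W p x
  have hae : ∀ᵐ ω ∂μn, ∀ b, ∀ i, 0 < g b (fun l => ∑ k, a l k * (ω i).1 k) (ω i).2 := by
    rw [ae_all_iff]
    intro b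
    rw [ae_all_iff]
    intro i
    exact (measurePreserving_eval (fun _ : Fin n => jointLaw W p x) i).quasiMeasurePreserving.ae
      (hpos b)
  have hle : μn.real {ω | (fun i => (ω i).2) ∉ typicalSet g θ (comb a fun k i => (ω i).1 k)} ≤
      μn.real (⋃ b ∈ (Finset.univ : Finset (Fin 2 → F)), {ω | n * θ b ≤ ∑ i, Z b (ω i)}) := by
    -- Points where some `g` vanishes are set apart, since `Real.log 0 = 0` would make them look
    -- typical; they form a null set.
    set N : Set (Fin n → (Fin K → F) × Y) :=
      {ω | ¬∀ b, ∀ i, 0 < g b (fun l => ∑ k, a l k * (ω i).1 k) (ω i).2} with hN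
    have hN0 : μn.real N = 0 := by
      rw [Measure.real, ae_iff.1 hae, ENNReal.toReal_zero]
    refine le_trans (measureReal_mono (s₂ := (⋃ b ∈ (Finset.univ : Finset (Fin 2 → F)),
      {ω | n * θ b ≤ ∑ i, Z b (ω i)}) ∪ N) ?_) ((measureReal_union_le _ _).trans (by rw [hN0, add_zero]))
    intro ω hmem
    by_cases hω : ∀ b, ∀ i, 0 < g b (fun l => ∑ k, a l k * (ω i).1 k) (ω i).2
    swap
    · exact Or.inr hω
    left
    simp only [typicalSet, Set.mem_ofPred_eq, not_forall, not_le] at hmem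
    obtain ⟨b, hb⟩ := hmem
    simp only [Set.mem_iUnion]
    refine ⟨b, Finset.mem_univ b, ?_⟩
    have hprod : 0 < ∏ i, g b (fun l => comb a (fun k i => (ω i).1 k) l i) (ω i).2 :=
      Finset.prod_pos fun i _ => hω b i
    have h1 := Real.log_le_log hprod hb.le
    simp only [comb] at h1
    rw [Real.log_exp, Real.log_prod fun i _ => (hω b i).ne'] at h1
    simp only [Set.mem_ofPred_eq, Z, Finset.sum_neg_distrib]
    linarith
  exact hle.trans (measureReal_biUnion_finset_le _ _)

/-- The strict inequalities leave room for a threshold `θ b` above the entropy `e b`, as typicality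
needs, and below the collision exponent, so that each term of the union bound decays exponentially.
-/
theorem exists_collision_exponents {e : (Fin 2 → F) → ℝ} {φ : Fin 2 → ℝ}
    (he : ∀ b, (b = 0 ∧ e b < φ 0 + φ 1) ∨ (b 1 ≠ 0 ∧ e b < φ 0) ∨ (b 0 ≠ 0 ∧ e b < φ 1)) :
    ∃ (θ : (Fin 2 → F) → ℝ) (τ : ℕ → (Fin 2 → F) → ℝ), (∀ b, e b < θ b) ∧
      (∀ n, CollisionWeight F (fun l => numRows (Fintype.card F) n (φ l)) (τ n)) ∧
      Tendsto (fun n : ℕ => ∑ b, Real.exp (n * θ b) * τ n b) atTop (𝓝 0) := by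
  have hq : 1 < Fintype.card F := Fintype.one_lt_card
  have hq0 : (0 : ℝ) < Fintype.card F := by positivity
  have hrow : ∀ (n : ℕ) (l : Fin 2),
      ((Fintype.card F : ℝ) ^ numRows (Fintype.card F) n (φ l))⁻¹ ≤ Real.exp (-(n * φ l)) := by
    intro n l
    rw [Real.exp_neg]
    exact inv_anti₀ (Real.exp_pos _) (exp_le_pow_numRows hq n (φ l))
  have key : ∀ {t c : ℝ} {τ : ℕ → ℝ}, t < c → (∀ n, 0 ≤ τ n) →
      (∀ n : ℕ, τ n ≤ Real.exp (-(n * c))) →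
      Tendsto (fun n : ℕ => Real.exp (n * t) * τ n) atTop (𝓝 0) := by
    intro t c τ htc h0 hle
    refine squeeze_zero (fun n => mul_nonneg (Real.exp_pos _).le (h0 n)) (fun n => ?_)
      (tendsto_exp_neg_mul (sub_neg.2 htc))
    refine (mul_le_mul_of_nonneg_left (hle n) (Real.exp_pos _).le).trans (le_of_eq ?_)
    rw [← Real.exp_add]
    congr 1
    ring
  have h : ∀ b, ∃ (t : ℝ) (τ : ℕ → ℝ), e b < t ∧
      (∀ n, ((b = 0 ∧ τ n = ((Fintype.card F : ℝ) ^ (numRows (Fintype.card F) n (φ 0) +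
        numRows (Fintype.card F) n (φ 1)))⁻¹) ∨
      (b 1 ≠ 0 ∧ τ n = ((Fintype.card F : ℝ) ^ numRows (Fintype.card F) n (φ 0))⁻¹) ∨
      (b 0 ≠ 0 ∧ τ n = ((Fintype.card F : ℝ) ^ numRows (Fintype.card F) n (φ 1))⁻¹))) ∧
      Tendsto (fun n : ℕ => Real.exp (n * t) * τ n) atTop (𝓝 0) := by
    intro b
    rcases he b with ⟨hb, h⟩ | ⟨hb, h⟩ | ⟨hb, h⟩ <;> obtain ⟨t, ht, ht'⟩ := exists_between h
    · refine ⟨t, fun n => _, ht, fun n => Or.inl ⟨hb, rfl⟩,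
        key ht' (fun n => by positivity) fun n => ?_⟩
      rw [pow_add, mul_inv, mul_add, neg_add, Real.exp_add]
      exact mul_le_mul (hrow n 0) (hrow n 1) (by positivity) (by positivity)
    · exact ⟨t, fun n => _, ht, fun n => Or.inr (Or.inl ⟨hb, rfl⟩),
        key ht' (fun n => by positivity) fun n => hrow n 0⟩
    · exact ⟨t, fun n => _, ht, fun n => Or.inr (Or.inr ⟨hb, rfl⟩),
        key ht' (fun n => by positivity) fun n => hrow n 1⟩
  choose θ τ h1 h2 h3 using h
  refine ⟨θ, fun n b => τ b n, h1, fun n b => h2 b n, ?_⟩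
  rw [← Finset.sum_const_zero (s := (Finset.univ : Finset (Fin 2 → F)))]
  exact tendsto_finsetSum _ fun b _ => h3 b

/-- Compute-forward over a finite field at the level of conditional pmf's: if the numbers `φ l` of
hash bits suffice for decoding, and the remaining entropy of each user suffices for its
messages, there are reliable codes. The sets `G n k` collect the messages for which encoding
succeeds. -/
theorem exists_reliable_codes {g : (Fin 2 → F) → (Fin 2 → F) → Y → ℝ}
    (hg : ∀ b w, Measurable (g b w)) (hg0 : ∀ b w y, 0 ≤ g b w y)
    (hg1 : ∀ b y v, (∑ w, if b ⬝ᵥ w = v then g b w y else 0) ≤ 1)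
    (hpos : ∀ b, ∀ᵐ ω ∂jointLaw W p x, 0 < g b (fun l => ∑ k, a l k * ω.1 k) ω.2)
    (hL2 : ∀ b, MemLp (fun ω : (Fin K → F) × Y =>
      -Real.log (g b (fun l => ∑ k, a l k * ω.1 k) ω.2)) 2 (jointLaw W p x))
    {e : (Fin 2 → F) → ℝ}
    (hge : ∀ b, ∫ ω, -Real.log (g b (fun l => ∑ k, a l k * ω.1 k) ω.2) ∂jointLaw W p x ≤ e b)
    {φ : Fin 2 → ℝ} (hφ : ∀ l, 0 ≤ φ l)
    (he : ∀ b, (b = 0 ∧ e b < φ 0 + φ 1) ∨ (b 1 ≠ 0 ∧ e b < φ 0) ∨ (b 0 ≠ 0 ∧ e b < φ 1))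
    {R : Fin K → ℝ} (hR : ∀ k, 0 ≤ R k)
    (hRφ : ∀ k l, a l k ≠ 0 →
      φ l + R k * Real.log 2 < ∑ v, Real.negMulLog (p k v).toReal) :
    ∃ (c : ∀ n k, Fin (numMsgs n (R k)) → Fin n → F) (G : ∀ n k, Set (Fin (numMsgs n (R k))))
      (dec : ∀ n, (Fin n → Y) → Fin 2 → Fin n → F), (∀ n, Measurable (dec n)) ∧
      (∀ n k, (∃ l, a l k ≠ 0) → Set.InjOn (c n k) (G n k)) ∧
      (∀ n k, ∀ m ∈ G n k, ∀ i, p k (c n k m i) ≠ 0) ∧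
      Tendsto (fun n => (∑ m : ∀ k, Fin (numMsgs n (R k)), if ∀ k, m k ∈ G n k then
        (Measure.pi fun i => W fun k => x k (c n k (m k) i)).real
          {y | dec n y ≠ comb a fun k => c n k (m k)} else 1) /
        ∏ k, (numMsgs n (R k) : ℝ)) atTop (𝓝 0) := by
  obtain ⟨θ, τ, hθ, hτ, hlim1⟩ := exists_collision_exponents he
  have hq : 1 < Fintype.card F := Fintype.one_lt_card
  have hq0 : (0 : ℝ) < Fintype.card F := by positivity
  have hκ : ∀ k, ∃ κ < ∑ v, Real.negMulLog (p k v).toReal,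
      ∀ l, a l k ≠ 0 → φ l + R k * Real.log 2 ≤ κ := by
    intro k
    have h : ∀ l, ∃ κ < ∑ v, Real.negMulLog (p k v).toReal,
        a l k ≠ 0 → φ l + R k * Real.log 2 ≤ κ := by
      intro l
      by_cases hl : a l k = 0
      · exact ⟨_, sub_one_lt _, fun h => absurd hl h⟩
      · exact ⟨_, hRφ k l hl, fun _ => le_rfl⟩
    choose κ h1 h2 using h
    refine ⟨max (κ 0) (κ 1), max_lt (h1 0) (h1 1), fun l hl => (h2 l hl).trans ?_⟩
    fin_cases l
    · exact le_max_left _ _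
    · exact le_max_right _ _
  choose κ hκ1 hκ2 using hκ
  -- `κ k` covers the hash and the message, and `η k` lies strictly between `κ k` and the entropy:
  -- inputs have probability at most `exp (-n η)` with high probability, and the total hash length
  -- stays below `n η`.
  have hη := fun k => exists_between (hκ1 k)
  choose η hη1 hη2 using hη
  let s : ℕ → Fin K → ℕ := fun n k =>
    if ∃ l, a l k ≠ 0 then Nat.clog (Fintype.card F) (numMsgs n (R k)) else 0
  have hs : ∀ n k, (∀ l, a l k = 0) → s n k = 0 := by
    intro n k hk
    simp [s, hk]
  have hM : ∀ n k, (∃ l, a l k ≠ 0) → numMsgs n (R k) ≤ Fintype.card F ^ s n k := by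
    intro n k hk
    simp only [s, if_pos hk]
    exact Nat.le_pow_clog hq _
  have hcode := fun n => exists_code_le W p x a hg hg0 hg1 θ (n := n) (hτ n) (s n) (hs n)
    (fun k => numMsgs n (R k)) (hM n)
    (fun k u => ∏ i, (p k (u i)).toReal ≤ Real.exp (-(n * η k)))
    (fun k => Real.exp (-(n * η k))) (fun k => (Real.exp_pos _).le) (fun k u h => h)
  choose c G dec hdec hinj hsupp hbound using hcode
  refine ⟨c, G, dec, hdec, hinj, hsupp, ?_⟩
  have hMpos : ∀ n, (0 : ℝ) < ∏ k, (numMsgs n (R k) : ℝ) := fun n =>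
    Finset.prod_pos fun k _ => by exact_mod_cast one_le_numMsgs n (R k)
  have hlim2 := tendsto_not_mem_typicalSet W p x a hpos hL2 (θ := θ)
    fun b => (hge b).trans_lt (hθ b)
  have hlim3 : ∀ k, Tendsto (fun n : ℕ => if ∃ l, a l k ≠ 0 then
      2 * (∑ u : Fin n → F, if ∏ i, (p k (u i)).toReal ≤ Real.exp (-(n * η k)) then 0
        else ∏ i, (p k (u i)).toReal) +
      √((Fintype.card F : ℝ) ^
        (frozen a (fun l => numRows (Fintype.card F) n (φ l)) k + s n k) *
          Real.exp (-(n * η k))) else 0) atTop (𝓝 0) := by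
    intro k
    by_cases hk : ∃ l, a l k ≠ 0
    · simp only [if_pos hk]
      suffices h : Tendsto (fun n : ℕ => (Fintype.card F : ℝ) ^
          (frozen a (fun l => numRows (Fintype.card F) n (φ l)) k + s n k) *
          Real.exp (-(n * η k))) atTop (𝓝 0) by
        simpa only [mul_zero, Real.sqrt_zero, add_zero] using
          ((tendsto_sum_atypical (p k) (hη2 k)).const_mul 2).add h.sqrt
      -- The constant collects the rounding losses: one factor `q` from the frozen rows and `2 q`
      -- from the message rows.
      have hlim : Tendsto (fun n : ℕ => 2 * (Fintype.card F : ℝ) ^ 2 *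
          Real.exp (n * (κ k - η k))) atTop (𝓝 0) := by
        simpa using (tendsto_exp_neg_mul (sub_neg.2 (hη1 k))).const_mul
          (2 * (Fintype.card F : ℝ) ^ 2)
      refine squeeze_zero (fun n => by positivity) (fun n => ?_) hlim
      have h1 := pow_frozen_le a n hφ hk (κ := κ k - R k * Real.log 2)
        fun l hl => by linarith [hκ2 k l hl]
      have h2 := pow_clog_numMsgs_le hq n (hR k)
      simp only [s, if_pos hk]
      rw [pow_add]
      calc _ ≤ (Fintype.card F * Real.exp (n * (κ k - R k * Real.log 2))) *
            (2 * Fintype.card F * Real.exp (n * (R k * Real.log 2))) * Real.exp (-(n * η k)) := by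
            gcongr
        _ = 2 * (Fintype.card F : ℝ) ^ 2 * (Real.exp (n * (κ k - R k * Real.log 2)) *
            Real.exp (n * (R k * Real.log 2)) * Real.exp (-(n * η k))) := by ring
        _ = _ := by
            rw [← Real.exp_add, ← Real.exp_add]
            congr 2
            ring
    · simp only [if_neg hk]
      exact tendsto_const_nhds
  have hlim := (hlim2.add hlim1).add (tendsto_finsetSum Finset.univ fun k _ => hlim3 k)
  simp only [add_zero, Finset.sum_const_zero] at hlim
  refine squeeze_zero (fun n => ?_) (fun n => ?_) hlim
  · refine div_nonneg (Finset.sum_nonneg fun m _ => ?_) (hMpos n).le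
    split_ifs
    · exact measureReal_nonneg
    · exact zero_le_one
  · rw [div_le_iff₀ (hMpos n), mul_comm]
    exact hbound n

end Asymptotics

/-! ### Conditional pmf's and their information densities -/

section Entropy

/-- Substituting the square root gives four times the square of `negMulLog`, which lies in [0, 1].
This bounds the second moment of an information density by the alphabet size. -/
theorem mul_log_sq_le {x : ℝ} (h0 : 0 ≤ x) (h1 : x ≤ 1) : x * Real.log x ^ 2 ≤ 4 := by
  have hy1 : √x ≤ 1 := Real.sqrt_le_one.2 h1
  have hn0 := Real.negMulLog_nonneg (Real.sqrt_nonneg x) hy1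
  have hn1 := Real.negMulLog_le_one_sub_self (Real.sqrt_nonneg x)
  have hy0 := Real.sqrt_nonneg x
  have heq : x * Real.log x ^ 2 = 4 * (√x).negMulLog ^ 2 := by
    rw [Real.negMulLog, Real.log_sqrt h0, mul_pow, neg_sq, Real.sq_sqrt h0]
    ring
  rw [heq]
  nlinarith

theorem measureEntropy_nonneg {S : Type*} [MeasurableSpace S] (ν : Measure S)
    [IsProbabilityMeasure ν] : 0 ≤ measureEntropy ν :=
  tsum_nonneg fun _ => div_nonneg (Real.negMulLog_nonneg measureReal_nonneg measureReal_le_one)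
    (Real.log_nonneg one_le_two)

theorem condEntropy_nonneg {Ω S 𝒯 : Type*} [MeasurableSpace Ω] [MeasurableSpace S]
    [StandardBorelSpace S] [Nonempty S] [MeasurableSpace 𝒯] (μ : Measure Ω) [IsFiniteMeasure μ]
    (Z : Ω → S) (T : Ω → 𝒯) : 0 ≤ condEntropy μ Z T :=
  integral_nonneg fun _ => measureEntropy_nonneg _

/-- The conditional pmf of a random variable `Z` with finitely many values given `T`. -/
theorem exists_condPmf {Ω S 𝒯 : Type*} [MeasurableSpace Ω] [MeasurableSpace S]
    [StandardBorelSpace S] [Nonempty S] [Countable S] [DiscreteMeasurableSpace S]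
    [MeasurableSpace 𝒯] (μ : Measure Ω) [IsProbabilityMeasure μ] {Z : Ω → S} {T : Ω → 𝒯}
    (hZ : Measurable Z) (hT : Measurable T) (B : Finset S) (hB : ∀ᵐ ω ∂μ, Z ω ∈ B) :
    ∃ g : S → 𝒯 → ℝ, (∀ z, Measurable (g z)) ∧ (∀ z t, 0 ≤ g z t) ∧
      (∀ t (s : Finset S), ∑ z ∈ s, g z t ≤ 1) ∧ (∀ᵐ ω ∂μ, 0 < g (Z ω) (T ω)) ∧
      MemLp (fun ω => -Real.log (g (Z ω) (T ω))) 2 μ ∧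
      ∫ ω, -Real.log (g (Z ω) (T ω)) ∂μ = condEntropy μ Z T * Real.log 2 := by
  set κ := condDistrib Z T μ with hκ
  set ν := μ.map T with hν
  have hTZ : Measurable fun ω => (T ω, Z ω) := hT.prodMk hZ
  have hmap : ν ⊗ₘ κ = μ.map fun ω => (T ω, Z ω) := compProd_map_condDistrib hZ.aemeasurable
  have : IsProbabilityMeasure ν := Measure.isProbabilityMeasure_map hT.aemeasurable
  let g : S → 𝒯 → ℝ := fun z t => (κ t).real {z}
  have hg : ∀ z, Measurable (g z) := fun z =>
    (Kernel.measurable_coe κ (measurableSet_singleton z)).ennreal_toReal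
  have hg0 : ∀ z t, 0 ≤ g z t := fun z t => measureReal_nonneg
  have hgle : ∀ z t, g z t ≤ 1 := fun z t => measureReal_le_one
  let G : 𝒯 × S → ℝ := fun ω => g ω.2 ω.1
  have hG : Measurable G := measurable_from_prod_countable_left hg
  have hpos : ∀ᵐ ω ∂(ν ⊗ₘ κ), 0 < G ω := by
    refine (Measure.ae_compProd_iff (measurableSet_lt measurable_const hG)).2
      (Eventually.of_forall fun t => ?_)
    rw [ae_iff_of_countable]
    intro z hz
    exact ENNReal.toReal_pos hz (measure_ne_top _ _)
  have hsupp : ∀ᵐ t ∂ν, ∀ z ∉ B, κ t {z} = 0 := by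
    have h1 : ∀ᵐ ω ∂(ν ⊗ₘ κ), ω.2 ∈ B := by
      rw [hmap]
      exact (ae_map_iff (p := fun ω : 𝒯 × S => ω.2 ∈ B) hTZ.aemeasurable
        (measurable_snd (Set.Finite.measurableSet B.finite_toSet))).2 hB
    have h2 := Measure.ae_ae_of_ae_compProd h1
    filter_upwards [h2] with t ht z hz
    by_contra hne
    exact hz ((ae_iff_of_countable.1 ht) z hne)
  have hlogm : Measurable fun ω => -Real.log (G ω) := (Real.measurable_log.comp hG).neg
  -- Almost every conditional law lives on the finite set `B`, and each of its points contributes at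
  -- most 4 to the second moment.
  have hL2 : MemLp (fun ω => -Real.log (G ω)) 2 (ν ⊗ₘ κ) := by
    rw [memLp_two_iff_integrable_sq hlogm.aestronglyMeasurable]
    refine ⟨(hlogm.pow_const 2).aestronglyMeasurable, ?_⟩
    rw [hasFiniteIntegral_iff_ofReal (Eventually.of_forall fun ω => sq_nonneg _),
      Measure.lintegral_compProd (hlogm.pow_const 2).ennreal_ofReal]
    refine lt_of_le_of_lt (lintegral_mono_ae (g := fun _ => (B.card : ENNReal) * 4) ?_) ?_
    · filter_upwards [hsupp] with t ht
      rw [lintegral_countable', tsum_eq_sum (s := B)]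
      · rw [← nsmul_eq_mul]
        refine Finset.sum_le_card_nsmul _ _ _ fun z _ => ?_
        have h1 : κ t {z} = ENNReal.ofReal (g z t) := by
          simp only [g]
          exact (ofReal_measureReal (measure_ne_top _ _)).symm
        rw [h1, ← ENNReal.ofReal_mul (sq_nonneg _)]
        refine ENNReal.ofReal_le_of_le_toReal ?_
        have := mul_log_sq_le (hg0 z t) (hgle z t)
        simp only [G, neg_sq]
        rw [mul_comm]
        simpa using this
      · intro z hz
        rw [ht z hz, mul_zero]
    · rw [lintegral_const, measure_univ, mul_one]
      exact ENNReal.mul_lt_top (ENNReal.natCast_lt_top _) (by norm_num)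
  have hint : ∫ ω, -Real.log (G ω) ∂(ν ⊗ₘ κ) = condEntropy μ Z T * Real.log 2 := by
    have hI := hL2.integrable one_le_two
    rw [Measure.integral_compProd hI, condEntropy, ← integral_mul_const]
    refine integral_congr_ae ?_
    have hlog2 : Real.log 2 ≠ 0 := (Real.log_pos one_lt_two).ne'
    filter_upwards [((Measure.integrable_compProd_iff hlogm.aestronglyMeasurable).1 hI).1] with t ht
    rw [integral_countable ht, measureEntropy, tsum_div_const, div_mul_cancel₀ _ hlog2]
    refine tsum_congr fun z => ?_
    simp only [G, g, Real.negMulLog, smul_eq_mul, ← hκ]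
    ring
  refine ⟨g, hg, hg0, ?_, ?_, ?_, ?_⟩
  · intro t s
    simp only [g]
    rw [sum_measureReal_singleton]
    exact measureReal_le_one
  · rw [hmap, ae_map_iff hTZ.aemeasurable (measurableSet_lt measurable_const hG)] at hpos
    exact hpos
  · rw [hmap, memLp_map_measure_iff hlogm.aestronglyMeasurable hTZ.aemeasurable] at hL2
    exact hL2
  · rw [hmap, integral_map hTZ.aemeasurable hlogm.aestronglyMeasurable] at hint
    exact hint

end Entropy

/-! ### Transfer of laws and entropies to the finite field -/

section Transfer

open scoped Classical

set_option linter.unusedSectionVars false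

variable {S : Type*} [CommRing S] [Countable S] [MeasurableSpace S] [DiscreteMeasurableSpace S]
  {F : Type*} [Field F] [Fintype F] [MeasurableSpace F] [DiscreteMeasurableSpace F]
  {K : ℕ} {X : Fin K → Type*} [∀ k, MeasurableSpace (X k)] {Y : Type*} [MeasurableSpace Y]

omit [CommRing S] in
theorem ae_pi_ne_zero (p : Fin K → PMF S) :
    ∀ᵐ u ∂Measure.pi fun k => (p k).toMeasure, ∀ k, p k (u k) ≠ 0 := by
  rw [ae_all_iff]
  intro k
  refine (measurePreserving_eval (fun k => (p k).toMeasure) k).quasiMeasurePreserving.ae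
    (p := fun s => p k s ≠ 0) ?_
  rw [ae_iff_of_countable]
  intro s hs
  rwa [PMF.toMeasure_apply_singleton _ _ (measurableSet_singleton _)] at hs

omit [CommRing S] in
theorem ae_jointLaw_ne_zero (W : Kernel (∀ k, X k) Y) [IsMarkovKernel W] (p : Fin K → PMF S)
    (x : ∀ k, S → X k) : ∀ᵐ ω ∂jointLaw W p x, ∀ k, p k (ω.1 k) ≠ 0 := by
  have hm : MeasurableSet {u : Fin K → S | ∀ k, p k (u k) ≠ 0} := .of_discrete
  rw [jointLaw]
  refine (Measure.ae_compProd_iff (p := fun ω : (Fin K → S) × Y => ∀ k, p k (ω.1 k) ≠ 0)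
    (measurable_fst hm)).2 ?_
  filter_upwards [ae_pi_ne_zero p] with u hu
  exact Eventually.of_forall fun _ => hu

omit [CommRing S] in
theorem map_rvU (W : Kernel (∀ k, X k) Y) [IsMarkovKernel W] (p : Fin K → PMF S)
    (x : ∀ k, S → X k) (k : Fin K) :
    (jointLaw W p x).map (rvU Y k) = (p k).toMeasure := by
  have h1 : rvU (S := S) Y k = (fun u : Fin K → S => u k) ∘ Prod.fst := rfl
  rw [h1, ← Measure.map_map (measurable_pi_apply k) measurable_fst]
  have h2 : (jointLaw W p x).map Prod.fst = Measure.pi fun k => (p k).toMeasure := by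
    have := Measure.fst_compProd (Measure.pi fun k => (p k).toMeasure)
      (W.comap (fun (u : Fin K → S) (k : Fin K) => x k (u k)) (measurable_symbolMap x))
    exact this
  rw [h2]
  exact (measurePreserving_eval (fun k => (p k).toMeasure) k).map_eq

/-- Reduction of the joint law along a ring homomorphism that is injective on the supports. -/
theorem map_jointLaw (π : S → F) (σ : F → S) (W : Kernel (∀ k, X k) Y) [IsMarkovKernel W]
    (p : Fin K → PMF S) (x : ∀ k, S → X k) (hσ : ∀ k s, p k s ≠ 0 → σ (π s) = s) :
    (jointLaw W p x).map (fun ω => ((fun k => π (ω.1 k)), ω.2)) =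
      jointLaw W (fun k => (p k).map π) (fun k v => x k (σ v)) := by
  have hπ : Measurable π := .of_discrete
  have hpi : Measurable fun (u : Fin K → S) k => π (u k) := by fun_prop
  have hm : Measurable fun ω : (Fin K → S) × Y => ((fun k => π (ω.1 k)), ω.2) := by fun_prop
  ext A hA
  rw [Measure.map_apply hm hA, jointLaw, jointLaw, Measure.compProd_apply (hm hA),
    Measure.compProd_apply hA]
  have hlaw : Measure.pi (fun k => ((p k).map π).toMeasure) =
      (Measure.pi fun k => (p k).toMeasure).map fun u k => π (u k) := by
    rw [Measure.pi_map_pi fun k => hπ.aemeasurable]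
    congr 1
    ext1 k
    exact (PMF.toMeasure_map π (p k) hπ).symm
  rw [hlaw, lintegral_map (Kernel.measurable_kernel_prodMk_left hA) hpi]
  refine lintegral_congr_ae ?_
  filter_upwards [ae_pi_ne_zero p] with u hu
  rw [Kernel.comap_apply, Kernel.comap_apply]
  have : (fun k => x k (σ (π (u k)))) = fun k => x k (u k) :=
    funext fun k => by rw [hσ k _ (hu k)]
  rw [this]
  rfl

omit [Countable S] [MeasurableSpace S] [DiscreteMeasurableSpace S] [CommRing S] [Field F]
  [Fintype F] [MeasurableSpace F] [DiscreteMeasurableSpace F] in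
theorem map_apply_of_leftInverse (π : S → F) (σ : F → S) (hπσ : ∀ v, π (σ v) = v) (p : PMF S)
    (hσ : ∀ s, p s ≠ 0 → σ (π s) = s) (v : F) : p.map π v = p (σ v) := by
  rw [PMF.map_apply, tsum_eq_single (σ v)]
  · simp [hπσ]
  · intro s hs
    by_cases h : p s = 0
    · simp [h]
    · rw [if_neg]
      rintro rfl
      exact hs (hσ s h).symm

/-- `π` is injective on the support of `p k`, so reduction only relabels the atoms; the factor `log
2` converts bits to nats. -/
theorem sum_negMulLog_map (π : S → F) (σ : F → S) (hπσ : ∀ v, π (σ v) = v)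
    (W : Kernel (∀ k, X k) Y) [IsMarkovKernel W] (p : Fin K → PMF S) (x : ∀ k, S → X k)
    (hσ : ∀ k s, p k s ≠ 0 → σ (π s) = s) (k : Fin K) :
    ∑ v, Real.negMulLog ((p k).map π v).toReal =
      entropy (jointLaw W p x) (rvU Y k) * Real.log 2 := by
  have hlog2 : Real.log 2 ≠ 0 := (Real.log_pos one_lt_two).ne'
  have hinj : Function.Injective σ := Function.LeftInverse.injective hπσ
  rw [entropy, map_rvU, measureEntropy, tsum_div_const, div_mul_cancel₀ _ hlog2]
  have h1 : ∀ s, (p k).toMeasure.real {s} = (p k s).toReal := fun s => by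
    rw [Measure.real, PMF.toMeasure_apply_singleton _ _ (measurableSet_singleton _)]
  simp only [h1, map_apply_of_leftInverse π σ hπσ (p k) (hσ k)]
  rw [← tsum_fintype (L := .unconditional _)]
  refine hinj.tsum_eq (f := fun s => Real.negMulLog (p k s).toReal) fun s hs => ?_
  refine ⟨π s, hσ k s fun h => hs ?_⟩
  simp [h]

/-- There is a family of conditional pmf's of the pair of linear combinations `a l` given the
output and the linear combination `b` of the pair, with expected code length at most `e`
(in nats). -/
def HasRate (W : Kernel (∀ k, X k) Y) (p : Fin K → PMF F) (x : ∀ k, F → X k)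
    (a : Fin 2 → Fin K → F) (b : Fin 2 → F) (e : ℝ) : Prop :=
  ∃ g : (Fin 2 → F) → Y → ℝ, (∀ w, Measurable (g w)) ∧ (∀ w y, 0 ≤ g w y) ∧
    (∀ y v, (∑ w, if b ⬝ᵥ w = v then g w y else 0) ≤ 1) ∧
    (∀ᵐ ω ∂jointLaw W p x, 0 < g (fun l => ∑ k, a l k * ω.1 k) ω.2) ∧
    MemLp (fun ω : (Fin K → F) × Y => -Real.log (g (fun l => ∑ k, a l k * ω.1 k) ω.2)) 2
      (jointLaw W p x) ∧
    ∫ ω, -Real.log (g (fun l => ∑ k, a l k * ω.1 k) ω.2) ∂jointLaw W p x ≤ e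

theorem HasRate.mono {W : Kernel (∀ k, X k) Y} {p : Fin K → PMF F} {x : ∀ k, F → X k}
    {a : Fin 2 → Fin K → F} {b : Fin 2 → F} {e e' : ℝ} (h : HasRate W p x a b e) (hle : e ≤ e') :
    HasRate W p x a b e' := by
  obtain ⟨g, h1, h2, h3, h4, h5, h6⟩ := h
  exact ⟨g, h1, h2, h3, h4, h5, h6.trans hle⟩

/-- A random variable `Z` that determines the pair of linear combinations, given `T`, yields
conditional pmf's of the pair. -/
theorem hasRate_condEntropy (π : S →+* F) (σ : F → S)
    (W : Kernel (∀ k, X k) Y) [IsMarkovKernel W]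
    (p : Fin K → PMF S) (x : ∀ k, S → X k)
    (hσ : ∀ k s, p k s ≠ 0 → σ (π s) = s) (a : Fin 2 → Fin K → S)
    {S' 𝒯 : Type*} [MeasurableSpace S'] [StandardBorelSpace S'] [Nonempty S'] [Countable S']
    [DiscreteMeasurableSpace S'] [MeasurableSpace 𝒯] {Z : (Fin K → S) × Y → S'}
    {T : (Fin K → S) × Y → 𝒯} (hZm : Measurable Z) (hTm : Measurable T)
    (ζ : (Fin 2 → F) → S') (τ : (Fin 2 → F) → Y → 𝒯) (hτ : ∀ w, Measurable (τ w))
    (hZ : ∀ ω : (Fin K → S) × Y, (∀ k, p k (ω.1 k) ≠ 0) →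
      Z ω = ζ fun l => π (∑ k, a l k * ω.1 k))
    (hT : ∀ ω : (Fin K → S) × Y, (∀ k, p k (ω.1 k) ≠ 0) →
      T ω = τ (fun l => π (∑ k, a l k * ω.1 k)) ω.2)
    (b : Fin 2 → F) (hb : ∀ w w', b ⬝ᵥ w = b ⬝ᵥ w' → τ w = τ w' ∧ (ζ w = ζ w' → w = w')) :
    HasRate W (fun k => (p k).map π) (fun k v => x k (σ v)) (fun l k => π (a l k)) b
      (condEntropy (jointLaw W p x) Z T * Real.log 2) := by
  have hae := ae_jointLaw_ne_zero W p x
  obtain ⟨g, h1, h2, h3, h4, h5, h6⟩ := exists_condPmf (jointLaw W p x) hZm hTm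
    (Finset.univ.image ζ) (by
      filter_upwards [hae] with ω hω
      rw [hZ ω hω]
      exact Finset.mem_image_of_mem _ (Finset.mem_univ _))
  have hπ : Measurable π := .of_discrete
  have hm : Measurable fun ω : (Fin K → S) × Y => ((fun k => π (ω.1 k)), ω.2) := by fun_prop
  have hmap := map_jointLaw π σ W p x hσ
  -- On a fibre of `b ⬝ᵥ w` the condition `τ w` is constant and `ζ` is injective, so these values
  -- are distinct atoms of a single conditional law and sum to at most 1.
  let g' : (Fin 2 → F) → Y → ℝ := fun w y => g (ζ w) (τ w y)
  have hg' : ∀ w, Measurable (g' w) := fun w => (h1 _).comp (hτ w)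
  let G : (Fin K → F) × Y → ℝ := fun ω => g' (fun l => ∑ k, π (a l k) * ω.1 k) ω.2
  have hG : Measurable G := by
    have hG' : Measurable fun ω : (Fin 2 → F) × Y => g' ω.1 ω.2 :=
      measurable_from_prod_countable_right hg'
    have hw : Measurable fun (u : Fin K → F) (l : Fin 2) => ∑ k, π (a l k) * u k := .of_discrete
    exact hG'.comp ((hw.comp measurable_fst).prodMk measurable_snd)
  have hGeq : ∀ᵐ ω ∂jointLaw W p x, g (Z ω) (T ω) = G ((fun k => π (ω.1 k)), ω.2) := by
    filter_upwards [hae] with ω hω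
    rw [hZ ω hω, hT ω hω]
    simp only [G, g', map_sum, map_mul]
  have hlogm : Measurable fun ω => -Real.log (G ω) := (Real.measurable_log.comp hG).neg
  have hlogeq : (fun ω => -Real.log (g (Z ω) (T ω))) =ᵐ[jointLaw W p x]
      fun ω => -Real.log (G ((fun k => π (ω.1 k)), ω.2)) := by
    filter_upwards [hGeq] with ω hω
    rw [hω]
  refine ⟨g', hg', fun w y => h2 _ _, ?_, ?_, ?_, ?_⟩
  · intro y v
    rw [← Finset.sum_filter]
    by_cases hne : ∃ w₀, b ⬝ᵥ w₀ = v
    · obtain ⟨w₀, hw₀⟩ := hne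
      have hinj : Set.InjOn ζ (Finset.univ.filter fun w => b ⬝ᵥ w = v : Finset (Fin 2 → F)) := by
        intro w hw w' hw' h
        simp only [Finset.coe_filter, Finset.mem_univ, true_and, Set.mem_ofPred_eq] at hw hw'
        exact (hb w w' (hw.trans hw'.symm)).2 h
      refine le_trans (le_of_eq ?_) (h3 (τ w₀ y)
        ((Finset.univ.filter fun w => b ⬝ᵥ w = v).image ζ))
      rw [Finset.sum_image hinj]
      refine Finset.sum_congr rfl fun w hw => ?_
      simp only [Finset.mem_filter, Finset.mem_univ, true_and] at hw
      simp only [g']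
      rw [(hb w w₀ (hw.trans hw₀.symm)).1]
    · rw [Finset.filter_false_of_mem fun w _ h => hne ⟨w, h⟩]
      simp
  · rw [← hmap]
    refine (ae_map_iff (p := fun ω => 0 < G ω) hm.aemeasurable
      (measurableSet_lt measurable_const hG)).2 ?_
    filter_upwards [h4, hGeq] with ω h h'
    rwa [← h']
  · rw [← hmap]
    refine (memLp_map_measure_iff (g := fun ω => -Real.log (G ω))
      hlogm.aestronglyMeasurable hm.aemeasurable).2 ?_
    exact h5.ae_eq hlogeq
  · rw [← hmap, integral_map (f := fun ω => -Real.log (G ω)) hm.aemeasurable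
      hlogm.aestronglyMeasurable, ← h6]
    exact (integral_congr_ae hlogeq).symm.le

end Transfer

/-- Extension of a partial injection on a finite type. -/
theorem exists_injective_extension {α β : Type*} [Fintype α] (h : Nonempty (α ↪ β)) (s : Set α)
    {f : α → β} (hf : Set.InjOn f s) : ∃ g : α → β, Function.Injective g ∧ ∀ a ∈ s, g a = f a := by
  classical
  obtain ⟨e⟩ := h
  let t₀ : Finset β := s.toFinset.image f
  have h1 : t₀ ⊆ t₀ ∪ Finset.univ.image e := Finset.subset_union_left
  have h2 : t₀.card ≤ Fintype.card α :=
    Finset.card_image_le.trans (Finset.card_le_univ _)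
  have h3 : Fintype.card α ≤ (t₀ ∪ Finset.univ.image e).card := by
    refine le_trans ?_ (Finset.card_le_card Finset.subset_union_right)
    rw [Finset.card_image_of_injective _ e.injective, Finset.card_univ]
  obtain ⟨t, ht1, -, ht2⟩ := Finset.exists_subsuperset_card_eq h1 h2 h3
  obtain ⟨g, hg⟩ := Finset.exists_equiv_extend_of_card_eq ht2.symm (s := s.toFinset) ht1
    (by simpa using hf)
  exact ⟨fun a => g a, Subtype.val_injective.comp g.injective, fun a ha => hg a (by simpa using ha)⟩

/-! ### From the finite field to codes over `𝔽`; choice of hash rates -/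

section Lift

open scoped Classical

set_option linter.unusedSectionVars false

variable {S : Type*} [CommRing S] [Countable S] [MeasurableSpace S] [DiscreteMeasurableSpace S]
  {F : Type*} [Field F] [Fintype F] [MeasurableSpace F] [DiscreteMeasurableSpace F]
  {K : ℕ} {X : Fin K → Type*} [∀ k, MeasurableSpace (X k)] {Y : Type*} [MeasurableSpace Y]

/-- Achievability over a field `𝔽`, with symbols in a subring `S` of `𝔽` that reduces to a finite
field `F`, such that the reduction is injective on the relevant elements. -/
theorem achievable_of_hasRate (π : S →+* F) (σ : F → S) (hπσ : ∀ v, π (σ v) = v)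
    {𝔽 : Type*} [Field 𝔽] [MeasurableSpace 𝔽] (j : S →+* 𝔽) (hj : Function.Injective j)
    (W : Kernel (∀ k, X k) Y) [IsMarkovKernel W] (p : Fin K → PMF S) (x : ∀ k, S → X k)
    (hσ : ∀ k s, p k s ≠ 0 → σ (π s) = s) (a : Fin 2 → Fin K → S)
    (ha : ∀ l k, a l k ≠ 0 → π (a l k) ≠ 0)
    (hW : ∀ u : Fin K → S, (∀ k, p k (u k) ≠ 0) → ∀ l,
      σ (π (∑ k, a l k * u k)) = ∑ k, a l k * u k)
    {R : Fin K → ℝ} (hR : ∀ k, 0 ≤ R k)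
    (hcard : ∀ n k, Nonempty (Fin (numMsgs n (R k)) ↪ (Fin n → 𝔽)))
    {e : (Fin 2 → F) → ℝ}
    (hrate : ∀ b, HasRate W (fun k => (p k).map π) (fun k v => x k (σ v))
      (fun l k => π (a l k)) b (e b))
    {φ : Fin 2 → ℝ} (hφ : ∀ l, 0 ≤ φ l)
    (he : ∀ b, (b = 0 ∧ e b < φ 0 + φ 1) ∨ (b 1 ≠ 0 ∧ e b < φ 0) ∨ (b 0 ≠ 0 ∧ e b < φ 1))
    (hRφ : ∀ k l, a l k ≠ 0 →
      φ l + R k * Real.log 2 < entropy (jointLaw W p x) (rvU Y k) * Real.log 2) :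
    Achievable W (fun l k => j (a l k)) R := by
  choose g hg hg0 hg1 hpos hL2 hge using hrate
  obtain ⟨c, G, dec, hdec, hinj, hsupp, hlim⟩ := exists_reliable_codes W
    (fun k => (p k).map π) (fun k v => x k (σ v)) (fun l k => π (a l k)) hg hg0 hg1 hpos hL2 hge hφ
    he hR (by
      intro k l hl
      rw [sum_negMulLog_map π σ hπσ W p x hσ k]
      exact hRφ k l fun h => hl (by rw [h, map_zero]))
  have hσinj : Function.Injective σ := Function.LeftInverse.injective hπσ
  -- Messages outside `G` are already counted as errors, so their representatives only need to keep
  -- `u` injective. Users with zero coefficients may use any injective labels.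
  have hext : ∀ n k, ∃ u : Fin (numMsgs n (R k)) → Fin n → 𝔽, Function.Injective u ∧
      ((∃ l, a l k ≠ 0) → ∀ m ∈ G n k, u m = fun i => j (σ (c n k m i))) := by
    intro n k
    by_cases hk : ∃ l, a l k ≠ 0
    · have h1 : Set.InjOn (fun m i => j (σ (c n k m i))) (G n k) := by
        intro m hm m' hm' h
        refine hinj n k ?_ hm hm' (funext fun i => hσinj (hj (congrFun h i)))
        obtain ⟨l, hl⟩ := hk
        exact ⟨l, ha l k hl⟩
      obtain ⟨u, hu, hu'⟩ := exists_injective_extension (hcard n k) (G n k) h1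
      exact ⟨u, hu, fun _ => hu'⟩
    · obtain ⟨u⟩ := hcard n k
      exact ⟨u, u.injective, fun h => absurd h hk⟩
  choose u huinj hu using hext
  let code : ∀ n, Code 𝔽 X Y 2 R n := fun n =>
    { u := u n
      u_injective := huinj n
      x := fun k m i => x k (σ (c n k m i))
      dec := fun y l i => j (σ (dec n y l i))
      measurable_dec := (Measurable.of_discrete
        (f := fun (w : Fin 2 → Fin n → F) l i => j (σ (w l i)))).comp (hdec n) }
  refine ⟨code, squeeze_zero (fun n => ?_) (fun n => ?_) hlim⟩
  · exact div_nonneg (Finset.sum_nonneg fun m _ => measureReal_nonneg)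
      (Finset.prod_nonneg fun k _ => Nat.cast_nonneg _)
  · refine div_le_div_of_nonneg_right (Finset.sum_le_sum fun m _ => ?_)
      (Finset.prod_nonneg fun k _ => Nat.cast_nonneg _)
    split_ifs with hm
    · refine measureReal_mono fun y hy hcon => hy ?_
      ext l i
      have h1 : ∀ k, p k (σ (c n k (m k) i)) ≠ 0 := fun k => by
        have := hsupp n k (m k) (hm k) i
        rwa [map_apply_of_leftInverse π σ hπσ (p k) (hσ k)] at this
      -- The codeword symbols lie in the supports, so the combination computed in `F` lifts back to
      -- the true one in `S`.
      have h2 := hW _ h1 l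
      simp only [map_sum, map_mul, hπσ] at h2
      have h3 : dec n y l i = ∑ k, π (a l k) * c n k (m k) i := congrFun (congrFun hcon l) i
      change j (σ (dec n y l i)) = ∑ k, j (a l k) * u n k (m k) i
      rw [h3, h2, map_sum]
      refine Finset.sum_congr rfl fun k _ => ?_
      by_cases hk : a l k = 0
      · simp [hk]
      · rw [map_mul, hu n k ⟨l, hk⟩ (m k) (hm k)]
    · exact measureReal_le_one

/-- The numbers of hash bits, per symbol. -/
theorem exists_hash_rates {a : Fin 2 → Fin K → S} (hne : ∀ l, ∃ k, a l k ≠ 0) {H R : Fin K → ℝ}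
    {C : Fin 2 → ℝ} {E : ℝ} (h1 : ∀ l k, a l k ≠ 0 → R k < H k - C l)
    (h2 : ∀ k i, a 0 k ≠ 0 → a 1 i ≠ 0 → R k + R i < H k + H i - E) :
    ∃ φ : Fin 2 → ℝ, (∀ l, C l < φ l) ∧ E < φ 0 + φ 1 ∧
      ∀ l k, a l k ≠ 0 → φ l + R k < H k := by
  have hmin : ∀ l, ∃ k, a l k ≠ 0 ∧ ∀ k', a l k' ≠ 0 → H k - R k ≤ H k' - R k' := by
    intro l
    obtain ⟨k₀, hk₀⟩ := hne l
    obtain ⟨k, hk, hmin⟩ := Finset.exists_min_image (Finset.univ.filter fun k => a l k ≠ 0)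
      (fun k => H k - R k) ⟨k₀, by simpa using hk₀⟩
    exact ⟨k, by simpa using hk, fun k' hk' => hmin k' (by simpa using hk')⟩
  choose κ hκ hκmin using hmin
  -- The largest admissible `φ l` is the minimum of `H k - R k` over the users of combination `l`;
  -- both are lowered by `δ` for strictness, which costs `2 * δ` in the sum constraint.
  obtain ⟨δ, hδ0, hδ⟩ : ∃ δ > 0, 2 * δ < min (min (H (κ 0) - R (κ 0) - C 0)
      (H (κ 1) - R (κ 1) - C 1)) (H (κ 0) - R (κ 0) + (H (κ 1) - R (κ 1)) - E) := by
    have hpos : 0 < min (min (H (κ 0) - R (κ 0) - C 0)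
      (H (κ 1) - R (κ 1) - C 1)) (H (κ 0) - R (κ 0) + (H (κ 1) - R (κ 1)) - E) := by
      refine lt_min (lt_min ?_ ?_) ?_
      · linarith [h1 0 _ (hκ 0)]
      · linarith [h1 1 _ (hκ 1)]
      · linarith [h2 _ _ (hκ 0) (hκ 1)]
    exact ⟨_ / 4, div_pos hpos four_pos, by linarith⟩
  rw [lt_min_iff, lt_min_iff] at hδ
  refine ⟨fun l => H (κ l) - R (κ l) - δ, ?_, ?_, ?_⟩
  · intro l
    fin_cases l <;> simp <;> linarith [hδ.1.1, hδ.1.2]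
  · linarith [hδ.2]
  · intro l k hk
    linarith [hκmin l k hk]

end Lift

/-! ### From the rate regions to hash rates -/

section Region

open scoped Classical

set_option linter.unusedSectionVars false

variable {S : Type*} [CommRing S] [Countable S] [MeasurableSpace S] [DiscreteMeasurableSpace S]
  {F : Type*} [Field F] [Fintype F] [MeasurableSpace F] [DiscreteMeasurableSpace F]
  {K : ℕ} {X : Fin K → Type*} [∀ k, MeasurableSpace (X k)] {Y : Type*} [MeasurableSpace Y]

/-- A reduction `π` of the ring `S` to the field `F`, with section `σ`, that is injective on the
supports of the symbols and of their linear combinations with coefficients `a`. -/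
structure IsReduction (π : S →+* F) (σ : F → S) (p : Fin K → PMF S) (a : Fin 2 → Fin K → S) :
    Prop where
  rightInv : ∀ v, π (σ v) = v
  symbol : ∀ k s, p k s ≠ 0 → σ (π s) = s
  coeff : ∀ l k, a l k ≠ 0 → π (a l k) ≠ 0
  comb : ∀ u : Fin K → S, (∀ k, p k (u k) ≠ 0) → ∀ l, σ (π (∑ k, a l k * u k)) = ∑ k, a l k * u k

theorem measurable_rvW (Y : Type*) [MeasurableSpace Y] (a : Fin K → S) : Measurable (rvW Y a) :=
  (Measurable.of_discrete (f := fun u : Fin K → S => ∑ k, a k * u k)).comp measurable_fst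

theorem measurable_rvV (Y : Type*) [MeasurableSpace Y] (a₁ a₂ : Fin K → S) (b : Fin 2 → S) :
    Measurable (rvV Y a₁ a₂ b) :=
  (Measurable.of_discrete (f := fun u : Fin K → S =>
    b 0 * ∑ k, a₁ k * u k + b 1 * ∑ k, a₂ k * u k)).comp measurable_fst

theorem measurable_rvY : Measurable (rvY S K Y) := measurable_snd

variable {π : S →+* F} {σ : F → S} (W : Kernel (∀ k, X k) Y) [IsMarkovKernel W]
  {p : Fin K → PMF S} (x : ∀ k, S → X k) {a₁ a₂ : Fin K → S}

/-- `b = 0` fixes nothing about the pair, so the conditioning is on the output alone. -/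
theorem IsReduction.hasRate_zero (h : IsReduction π σ p ![a₁, a₂]) :
    HasRate W (fun k => (p k).map π) (fun k v => x k (σ v)) (fun l k => π (![a₁, a₂] l k)) 0
      (condEntropy (jointLaw W p x) (fun ω => (rvW Y a₁ ω, rvW Y a₂ ω)) (rvY S K Y) *
        Real.log 2) := by
  have hinj : Function.Injective σ := Function.LeftInverse.injective h.rightInv
  refine hasRate_condEntropy π σ W p x h.symbol ![a₁, a₂]
    ((measurable_rvW Y a₁).prodMk (measurable_rvW Y a₂)) measurable_rvY
    (fun w => (σ (w 0), σ (w 1))) (fun _ y => y) (fun _ => measurable_id) ?_ (fun _ _ => rfl) 0 ?_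
  · intro ω hω
    rw [h.comb _ hω, h.comb _ hω]
    rfl
  · intro w w' _
    refine ⟨rfl, fun hw => ?_⟩
    rw [Prod.mk.injEq] at hw
    ext l
    fin_cases l
    · exact hinj hw.1
    · exact hinj hw.2

/-- Fixing the combination `b` amounts to fixing the first member of the pair; only the second is
left uncertain. -/
theorem IsReduction.hasRate_fst (h : IsReduction π σ p ![a₁, a₂]) {b : Fin 2 → F}
    (hb0 : b 0 ≠ 0) (hb1 : b 1 = 0) :
    HasRate W (fun k => (p k).map π) (fun k v => x k (σ v)) (fun l k => π (![a₁, a₂] l k)) b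
      (condEntropy (jointLaw W p x) (rvW Y a₂) (fun ω => (rvY S K Y ω, rvW Y a₁ ω)) *
        Real.log 2) := by
  have hinj : Function.Injective σ := Function.LeftInverse.injective h.rightInv
  refine hasRate_condEntropy π σ W p x h.symbol ![a₁, a₂]
    (measurable_rvW Y a₂) (measurable_rvY.prodMk (measurable_rvW Y a₁))
    (fun w => σ (w 1)) (fun w y => (y, σ (w 0))) (fun _ => by fun_prop) ?_ ?_ b ?_
  · intro ω hω
    rw [h.comb _ hω]
    rfl
  · intro ω hω
    rw [h.comb _ hω]
    rfl
  · intro w w' hw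
    simp only [dotProduct, Fin.sum_univ_two, hb1, zero_mul, add_zero] at hw
    have h0 := mul_left_cancel₀ hb0 hw
    refine ⟨by rw [h0], fun hw' => ?_⟩
    ext l
    fin_cases l
    · exact h0
    · exact hinj hw'

theorem IsReduction.hasRate_snd (h : IsReduction π σ p ![a₁, a₂]) {b : Fin 2 → F}
    (hb0 : b 0 = 0) (hb1 : b 1 ≠ 0) :
    HasRate W (fun k => (p k).map π) (fun k v => x k (σ v)) (fun l k => π (![a₁, a₂] l k)) b
      (condEntropy (jointLaw W p x) (rvW Y a₁) (fun ω => (rvY S K Y ω, rvW Y a₂ ω)) *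
        Real.log 2) := by
  have hinj : Function.Injective σ := Function.LeftInverse.injective h.rightInv
  refine hasRate_condEntropy π σ W p x h.symbol ![a₁, a₂]
    (measurable_rvW Y a₁) (measurable_rvY.prodMk (measurable_rvW Y a₂))
    (fun w => σ (w 0)) (fun w y => (y, σ (w 1))) (fun _ => by fun_prop) ?_ ?_ b ?_
  · intro ω hω
    rw [h.comb _ hω]
    rfl
  · intro ω hω
    rw [h.comb _ hω]
    rfl
  · intro w w' hw
    simp only [dotProduct, Fin.sum_univ_two, hb0, zero_mul, zero_add] at hw
    have h1 := mul_left_cancel₀ hb1 hw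
    refine ⟨by rw [h1], fun hw' => ?_⟩
    ext l
    fin_cases l
    · exact hinj hw'
    · exact h1

/-- `max {H(V_b | Y), H(W_{a₁}, W_{a₂} | Y, V_b)}`. -/
noncomputable def successiveEntropy (p : Fin K → PMF S) (a₁ a₂ : Fin K → S) (b : Fin 2 → S) : ℝ :=
  max (condEntropy (jointLaw W p x) (rvV Y a₁ a₂ b) (rvY S K Y))
    (condEntropy (jointLaw W p x) (fun ω => (rvW Y a₁ ω, rvW Y a₂ ω))
      (fun ω => (rvY S K Y ω, rvV Y a₁ a₂ b ω)))

/-- One `c` serves every direction `b`. If the determinant of `b` and the reduction of `c` vanishes,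
then fixing `b ⬝ᵥ w` fixes V_c, and the pair is coded given V_c. Otherwise `b ⬝ᵥ w` and V_c
determine the pair, and it suffices to code V_c. -/
theorem IsReduction.hasRate_successive (h : IsReduction π σ p ![a₁, a₂]) {c : Fin 2 → S}
    (hV : ∀ u : Fin K → S, (∀ k, p k (u k) ≠ 0) →
      σ (π (c 0 * ∑ k, a₁ k * u k + c 1 * ∑ k, a₂ k * u k)) =
        c 0 * ∑ k, a₁ k * u k + c 1 * ∑ k, a₂ k * u k)
    {b : Fin 2 → F} (hb : b ≠ 0) :
    HasRate W (fun k => (p k).map π) (fun k v => x k (σ v)) (fun l k => π (![a₁, a₂] l k)) b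
      (successiveEntropy W x p a₁ a₂ c * Real.log 2) := by
  have hinj : Function.Injective σ := Function.LeftInverse.injective h.rightInv
  have hlog : 0 ≤ Real.log 2 := Real.log_nonneg one_le_two
  have hVω : ∀ ω : (Fin K → S) × Y, (∀ k, p k (ω.1 k) ≠ 0) → rvV Y a₁ a₂ c ω =
      σ ((fun l => π (c l)) ⬝ᵥ fun l => π (∑ k, ![a₁, a₂] l k * ω.1 k)) := by
    intro ω hω
    refine (hV ω.1 hω).symm.trans ?_
    congr 1
    simp [dotProduct, Fin.sum_univ_two]
  by_cases hdet : b 0 * π (c 1) - b 1 * π (c 0) = 0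
  · refine HasRate.mono ?_ (mul_le_mul_of_nonneg_right (le_max_right _ _) hlog)
    refine hasRate_condEntropy π σ W p x h.symbol ![a₁, a₂]
      ((measurable_rvW Y a₁).prodMk (measurable_rvW Y a₂))
      (measurable_rvY.prodMk (measurable_rvV Y a₁ a₂ c))
      (fun w => (σ (w 0), σ (w 1))) (fun w y => (y, σ ((fun l => π (c l)) ⬝ᵥ w)))
      (fun _ => by fun_prop) ?_ ?_ b ?_
    · intro ω hω
      rw [h.comb _ hω, h.comb _ hω]
      rfl
    · intro ω hω
      rw [hVω ω hω]
      rfl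
    · intro w w' hw
      constructor
      · have : (fun l => π (c l)) ⬝ᵥ w = (fun l => π (c l)) ⬝ᵥ w' := by
          simp only [dotProduct, Fin.sum_univ_two] at hw ⊢
          by_cases hb0 : b 0 = 0
          · have hb1 : b 1 ≠ 0 := fun hb1 => hb (by
              ext l
              fin_cases l
              · exact hb0
              · exact hb1)
            refine mul_left_cancel₀ hb1 ?_
            linear_combination π (c 1) * hw + (w' 0 - w 0) * hdet
          · refine mul_left_cancel₀ hb0 ?_
            linear_combination π (c 0) * hw + (w 1 - w' 1) * hdet
        rw [this]
      · intro hw'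
        rw [Prod.mk.injEq] at hw'
        ext l
        fin_cases l
        · exact hinj hw'.1
        · exact hinj hw'.2
  · refine HasRate.mono ?_ (mul_le_mul_of_nonneg_right (le_max_left _ _) hlog)
    refine hasRate_condEntropy π σ W p x h.symbol ![a₁, a₂] (measurable_rvV Y a₁ a₂ c)
      measurable_rvY (fun w => σ ((fun l => π (c l)) ⬝ᵥ w)) (fun _ y => y)
      (fun _ => measurable_id) ?_ (fun _ _ => rfl) b ?_
    · intro ω hω
      exact hVω ω hω
    · intro w w' hw
      refine ⟨rfl, fun hw' => ?_⟩
      replace hw' := hinj hw'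
      simp only [dotProduct, Fin.sum_univ_two] at hw hw'
      have h0 : w 0 = w' 0 := by
        refine mul_left_cancel₀ hdet ?_
        linear_combination π (c 1) * hw - b 1 * hw'
      have h1 : w 1 = w' 1 := by
        refine mul_left_cancel₀ hdet ?_
        linear_combination b 0 * hw' - π (c 0) * hw
      ext l
      fin_cases l
      · exact h0
      · exact h1

theorem successiveEntropy_nonneg (p : Fin K → PMF S) (a₁ a₂ : Fin K → S) (b : Fin 2 → S) :
    0 ≤ successiveEntropy W x p a₁ a₂ b :=
  (condEntropy_nonneg _ _ _).trans (le_max_left _ _)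

/-- `C l` is the largest cost, in bits, among the directions `b` assigned to the hash of combination
`l`; the joint case `b = 0` is paid for by both hashes and yields the sum constraint. -/
theorem IsReduction.achievable (h : IsReduction π σ p ![a₁, a₂])
    {𝔽 : Type*} [Field 𝔽] [MeasurableSpace 𝔽] {j : S →+* 𝔽} (hj : Function.Injective j)
    (hne : ∀ l, ∃ k, ![a₁, a₂] l k ≠ 0) {R : Fin K → ℝ} (hR : ∀ k, 0 ≤ R k)
    (hcard : ∀ n k, Nonempty (Fin (numMsgs n (R k)) ↪ (Fin n → 𝔽)))
    {C : Fin 2 → ℝ} (hC0 : ∀ l, 0 ≤ C l)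
    (hC : ∀ b : Fin 2 → F, b ≠ 0 →
      (b 1 ≠ 0 ∧ HasRate W (fun k => (p k).map π) (fun k v => x k (σ v))
        (fun l k => π (![a₁, a₂] l k)) b (C 0 * Real.log 2)) ∨
      (b 0 ≠ 0 ∧ HasRate W (fun k => (p k).map π) (fun k v => x k (σ v))
        (fun l k => π (![a₁, a₂] l k)) b (C 1 * Real.log 2)))
    (h1 : ∀ l k, ![a₁, a₂] l k ≠ 0 → R k < entropy (jointLaw W p x) (rvU Y k) - C l)
    (h2 : ∀ k i, a₁ k ≠ 0 → a₂ i ≠ 0 → R k + R i < sumRate W p x a₁ a₂ k i) :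
    Achievable W ![fun k => j (a₁ k), fun k => j (a₂ k)] R := by
  have hlog : 0 < Real.log 2 := Real.log_pos one_lt_two
  obtain ⟨φ, hφ1, hφ2, hφ3⟩ := exists_hash_rates hne h1
    (E := condEntropy (jointLaw W p x) (fun ω => (rvW Y a₁ ω, rvW Y a₂ ω)) (rvY S K Y))
    (fun k i hk hi => by
      have := h2 k i hk hi
      simp only [sumRate, mutualInfo] at this
      linarith)
  have hex : ∀ b : Fin 2 → F, ∃ e, HasRate W (fun k => (p k).map π) (fun k v => x k (σ v))
      (fun l k => π (![a₁, a₂] l k)) b e ∧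
      ((b = 0 ∧ e < φ 0 * Real.log 2 + φ 1 * Real.log 2) ∨ (b 1 ≠ 0 ∧ e < φ 0 * Real.log 2) ∨
        (b 0 ≠ 0 ∧ e < φ 1 * Real.log 2)) := by
    intro b
    by_cases hb : b = 0
    · subst hb
      refine ⟨_, h.hasRate_zero W x, Or.inl ⟨rfl, ?_⟩⟩
      rw [← add_mul]
      exact mul_lt_mul_of_pos_right hφ2 hlog
    · rcases hC b hb with hb' | hb'
      · exact ⟨_, hb'.2, Or.inr (Or.inl ⟨hb'.1, mul_lt_mul_of_pos_right (hφ1 0) hlog⟩)⟩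
      · exact ⟨_, hb'.2, Or.inr (Or.inr ⟨hb'.1, mul_lt_mul_of_pos_right (hφ1 1) hlog⟩)⟩
  choose e he1 he2 using hex
  have := achievable_of_hasRate π σ h.rightInv j hj W p x h.symbol ![a₁, a₂] h.coeff h.comb hR
    hcard he1 (φ := fun l => φ l * Real.log 2)
    (fun l => mul_nonneg ((hC0 l).trans (hφ1 l).le) hlog.le) he2
    (fun k l hl => by
      rw [← add_mul]
      exact mul_lt_mul_of_pos_right (hφ3 l k hl) hlog)
  convert this using 1
  ext l k
  fin_cases l <;> rfl

/-- A single linear combination `b` serves all users. -/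
theorem exists_lt_sub_successiveEntropy [Nontrivial S] (p : Fin K → PMF S) (a₁ a₂ : Fin K → S)
    {P : Fin K → Prop} (hP : ∃ k, P k) {R : Fin K → ℝ}
    (hR : ∀ k, P k → R k < maxMinRate W p x a₁ a₂ k) :
    ∃ b : Fin 2 → S, ∀ k, P k →
      R k < entropy (jointLaw W p x) (rvU Y k) - successiveEntropy W x p a₁ a₂ b := by
  have : Nonempty {b : Fin 2 → S // b ≠ 0} := ⟨⟨1, one_ne_zero⟩⟩
  have hex : ∀ k, ∃ b : Fin 2 → S, P k →
      R k < entropy (jointLaw W p x) (rvU Y k) - successiveEntropy W x p a₁ a₂ b := by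
    intro k
    by_cases hk : P k
    · obtain ⟨b, hb⟩ := exists_lt_of_lt_ciSup (hR k hk)
      refine ⟨b.1, fun _ => ?_⟩
      rw [lt_min_iff] at hb
      have : successiveEntropy W x p a₁ a₂ b.1 < entropy (jointLaw W p x) (rvU Y k) - R k :=
        max_lt (by linarith [hb.1]) (by linarith [hb.2])
      linarith
    · exact ⟨1, fun h => absurd h hk⟩
  choose b hb using hex
  obtain ⟨k₀, hk₀⟩ := hP
  -- The rate bound depends on `b` only through `successiveEntropy`, with H(U_k) added, so the `b`
  -- of smallest value is at least as good for every user.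
  obtain ⟨k, hk, hmin⟩ := Finset.exists_min_image (Finset.univ.filter P)
    (fun k => successiveEntropy W x p a₁ a₂ (b k)) ⟨k₀, by simpa using hk₀⟩
  refine ⟨b k, fun k' hk' => ?_⟩
  have := hmin k' (by simpa using hk')
  linarith [hb k' hk']

/-- The rate constraints with the maximizing linear combination `b`. -/
def MeetsRates (W : Kernel (∀ k, X k) Y) [IsMarkovKernel W] (p : Fin K → PMF S)
    (x : ∀ k, S → X k) (a₁ a₂ : Fin K → S) (b : Fin 2 → S) (R : Fin K → ℝ) : Prop :=
  (∀ k i, a₁ k ≠ 0 → a₂ i ≠ 0 → R k + R i < sumRate W p x a₁ a₂ k i) ∧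
  (((∀ k, a₁ k ≠ 0 →
      R k < entropy (jointLaw W p x) (rvU Y k) - successiveEntropy W x p a₁ a₂ b) ∧
    ∀ k, a₂ k ≠ 0 → R k < singleRate W p x a₂ a₁ k) ∨
  ((∀ k, a₁ k ≠ 0 → R k < singleRate W p x a₁ a₂ k) ∧
    ∀ k, a₂ k ≠ 0 →
      R k < entropy (jointLaw W p x) (rvU Y k) - successiveEntropy W x p a₁ a₂ b))

theorem exists_meetsRates [Nontrivial S] {p : Fin K → PMF S} {x : ∀ k, S → X k}
    {a₁ a₂ : Fin K → S} (hne : ∀ l, ∃ k, ![a₁, a₂] l k ≠ 0) {R : Fin K → ℝ}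
    (hR : R ∈ region₁ W p x a₁ a₂ ∪ region₂ W p x a₁ a₂) :
    ∃ b : Fin 2 → S, MeetsRates W p x a₁ a₂ b R := by
  rcases hR with ⟨h1, h2, h3⟩ | ⟨h1, h2, h3⟩
  · obtain ⟨b, hb⟩ := exists_lt_sub_successiveEntropy W x p a₁ a₂
      (P := fun k => a₁ k ≠ 0) (hne 0) h1
    exact ⟨b, h3, Or.inl ⟨hb, h2⟩⟩
  · obtain ⟨b, hb⟩ := exists_lt_sub_successiveEntropy W x p a₁ a₂
      (P := fun k => a₂ k ≠ 0) (hne 1) h2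
    exact ⟨b, h3, Or.inr ⟨h1, hb⟩⟩

/-- Over a finite field this ensures that `𝔽^n` has room for injective representatives of the users
taking part. -/
theorem MeetsRates.lt_entropy {p : Fin K → PMF S} {x : ∀ k, S → X k}
    {a₁ a₂ : Fin K → S} {b : Fin 2 → S} {R : Fin K → ℝ} (h : MeetsRates W p x a₁ a₂ b R)
    {k : Fin K} (hk : a₁ k ≠ 0 ∨ a₂ k ≠ 0) : R k < entropy (jointLaw W p x) (rvU Y k) := by
  have h0 := successiveEntropy_nonneg W x p a₁ a₂ b
  have h1 := condEntropy_nonneg (jointLaw W p x) (rvW Y a₂) (fun ω => (rvY S K Y ω, rvW Y a₁ ω))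
  have h2 := condEntropy_nonneg (jointLaw W p x) (rvW Y a₁) (fun ω => (rvY S K Y ω, rvW Y a₂ ω))
  simp only [MeetsRates, singleRate, mutualInfo] at h
  rcases h.2 with ⟨h3, h4⟩ | ⟨h3, h4⟩ <;> rcases hk with hk | hk
  · linarith [h3 k hk]
  · linarith [h4 k hk]
  · linarith [h3 k hk]
  · linarith [h4 k hk]

/-- The hash whose users meet the `successiveEntropy` bound handles every direction except the one
in which its own difference may vanish; the other hash handles that one, at the cost of a single
conditional entropy. -/
theorem IsReduction.achievable_of_meetsRates (h : IsReduction π σ p ![a₁, a₂])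
    {𝔽 : Type*} [Field 𝔽] [MeasurableSpace 𝔽] {j : S →+* 𝔽} (hj : Function.Injective j)
    (hne : ∀ l, ∃ k, ![a₁, a₂] l k ≠ 0) {R : Fin K → ℝ} (hR : ∀ k, 0 ≤ R k)
    (hcard : ∀ n k, Nonempty (Fin (numMsgs n (R k)) ↪ (Fin n → 𝔽)))
    {c : Fin 2 → S}
    (hV : ∀ u : Fin K → S, (∀ k, p k (u k) ≠ 0) →
      σ (π (c 0 * ∑ k, a₁ k * u k + c 1 * ∑ k, a₂ k * u k)) =
        c 0 * ∑ k, a₁ k * u k + c 1 * ∑ k, a₂ k * u k)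
    (hrates : MeetsRates W p x a₁ a₂ c R) :
    Achievable W ![fun k => j (a₁ k), fun k => j (a₂ k)] R := by
  obtain ⟨hsum, ⟨h1, h2⟩ | ⟨h1, h2⟩⟩ := hrates
  · refine h.achievable W x hj hne hR hcard (C := ![successiveEntropy W x p a₁ a₂ c,
      condEntropy (jointLaw W p x) (rvW Y a₂) (fun ω => (rvY S K Y ω, rvW Y a₁ ω))])
      (fun l => ?_) (fun b hb => ?_) (fun l k hk => ?_) hsum
    · fin_cases l
      · exact successiveEntropy_nonneg W x p a₁ a₂ c
      · exact condEntropy_nonneg _ _ _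
    · by_cases hb1 : b 1 = 0
      · have hb0 : b 0 ≠ 0 := fun hb0 => hb (by
          ext l
          fin_cases l
          · exact hb0
          · exact hb1)
        exact Or.inr ⟨hb0, h.hasRate_fst W x hb0 hb1⟩
      · exact Or.inl ⟨hb1, h.hasRate_successive W x hV hb⟩
    · fin_cases l
      · exact h1 k hk
      · have := h2 k hk
        simp only [singleRate, mutualInfo] at this
        simp
        linarith
  · refine h.achievable W x hj hne hR hcard (C :=
      ![condEntropy (jointLaw W p x) (rvW Y a₁) (fun ω => (rvY S K Y ω, rvW Y a₂ ω)),
      successiveEntropy W x p a₁ a₂ c])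
      (fun l => ?_) (fun b hb => ?_) (fun l k hk => ?_) hsum
    · fin_cases l
      · exact condEntropy_nonneg _ _ _
      · exact successiveEntropy_nonneg W x p a₁ a₂ c
    · by_cases hb0 : b 0 = 0
      · have hb1 : b 1 ≠ 0 := fun hb1 => hb (by
          ext l
          fin_cases l
          · exact hb0
          · exact hb1)
        exact Or.inl ⟨hb1, h.hasRate_snd W x hb0 hb1⟩
      · exact Or.inr ⟨hb0, h.hasRate_successive W x hV hb⟩
    · fin_cases l
      · have := h1 k hk
        simp only [singleRate, mutualInfo] at this
        simp
        linarith
      · exact h2 k hk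

end Region

/-! ### Room for the messages; recovering integers modulo a prime -/

section Alphabets

/-- Gibbs' inequality against the uniform law: `negMulLog t ≤ 1 - t` at `t = q * P v`, summed over
`v`. -/
theorem sum_negMulLog_le_log_card {F : Type*} [Fintype F] [Nonempty F] {P : F → ℝ}
    (h0 : ∀ v, 0 ≤ P v) (h1 : ∑ v, P v = 1) :
    ∑ v, Real.negMulLog (P v) ≤ Real.log (Fintype.card F) := by
  have hq : (0 : ℝ) < Fintype.card F := by exact_mod_cast Fintype.card_pos
  have key : ∀ v, Real.negMulLog (P v) ≤
      P v * Real.log (Fintype.card F) + ((Fintype.card F : ℝ)⁻¹ - P v) := by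
    intro v
    have h := Real.negMulLog_le_one_sub_self (mul_nonneg (h0 v) hq.le)
    rw [Real.negMulLog_mul] at h
    have h2 : (Fintype.card F : ℝ) * Real.negMulLog (P v) ≤ (Fintype.card F : ℝ) *
        (P v * Real.log (Fintype.card F) + ((Fintype.card F : ℝ)⁻¹ - P v)) := by
      rw [mul_add, mul_sub, mul_inv_cancel₀ hq.ne']
      simp only [Real.negMulLog] at h ⊢
      linarith
    exact le_of_mul_le_mul_left h2 hq
  refine (Finset.sum_le_sum fun v _ => key v).trans (le_of_eq ?_)
  rw [Finset.sum_add_distrib, Finset.sum_sub_distrib, ← Finset.sum_mul, h1, Finset.sum_const,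
    Finset.card_univ, nsmul_eq_mul, mul_inv_cancel₀ hq.ne']
  ring

theorem entropy_rvU_le {F : Type*} [Fintype F] [Nonempty F] [MeasurableSpace F]
    [DiscreteMeasurableSpace F] {K : ℕ} {X : Fin K → Type*} [∀ k, MeasurableSpace (X k)]
    {Y : Type*} [MeasurableSpace Y] (W : Kernel (∀ k, X k) Y) [IsMarkovKernel W]
    (p : Fin K → PMF F) (x : ∀ k, F → X k) (k : Fin K) :
    entropy (jointLaw W p x) (rvU Y k) ≤ Real.logb 2 (Fintype.card F) := by
  rw [entropy, map_rvU, measureEntropy, tsum_div_const, tsum_fintype, Real.logb]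
  refine div_le_div_of_nonneg_right (sum_negMulLog_le_log_card (fun _ => measureReal_nonneg) ?_)
    (Real.log_nonneg one_le_two)
  rw [sum_measureReal_singleton]
  simp

theorem nonempty_embedding_of_le_logb {F : Type*} [Fintype F] [Nonempty F] {r : ℝ}
    (hr : r ≤ Real.logb 2 (Fintype.card F)) (n : ℕ) :
    Nonempty (Fin (numMsgs n r) ↪ (Fin n → F)) := by
  refine Function.Embedding.nonempty_of_card_le ?_
  have hq : (0 : ℝ) < Fintype.card F := by exact_mod_cast Fintype.card_pos
  rw [Fintype.card_fin, Fintype.card_fun, Fintype.card_fin, numMsgs, Nat.ceil_le]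
  push_cast
  calc (2 : ℝ) ^ ((n : ℝ) * r) ≤ 2 ^ ((n : ℝ) * Real.logb 2 (Fintype.card F)) :=
        Real.rpow_le_rpow_of_exponent_le one_le_two
          (mul_le_mul_of_nonneg_left hr (Nat.cast_nonneg n))
    _ = (Fintype.card F : ℝ) ^ n := by
        rw [mul_comm, Real.rpow_mul two_pos.le, Real.rpow_logb two_pos (by norm_num) hq,
          Real.rpow_natCast]

theorem nonempty_embedding_of_infinite {𝔽 : Type*} [Infinite 𝔽] (r : ℝ) (n : ℕ) :
    Nonempty (Fin (numMsgs n r) ↪ (Fin n → 𝔽)) := by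
  -- At block length 0 there is one message and one empty sequence.
  rcases Nat.eq_zero_or_pos n with rfl | hn
  · have : numMsgs 0 r = 1 := by simp [numMsgs]
    rw [this]
    exact Function.Embedding.nonempty_of_card_le (by simp)
  · have : Infinite (Fin n → 𝔽) := 
      Infinite.of_injective (fun (a : 𝔽) (_ : Fin n) => a) fun a b h => congrFun h ⟨0, hn⟩
    exact ⟨Fin.valEmbedding.trans (Infinite.natEmbedding _)⟩

theorem valMinAbs_intCast {P : ℕ} [NeZero P] {z : ℤ} (hz : 2 * |z| < P) :
    ((z : ZMod P)).valMinAbs = z := by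
  rw [ZMod.valMinAbs_spec]
  refine ⟨rfl, ?_, ?_⟩ <;> cases abs_cases z <;> omega

/-- The integers in a finite set are recovered from their residues modulo a large prime. -/
theorem exists_prime_valMinAbs {D : Set ℤ} (hD : D.Finite) :
    ∃ P : ℕ, P.Prime ∧ ∀ z ∈ D, ((z : ZMod P)).valMinAbs = z := by
  obtain ⟨N, hN⟩ : ∃ N : ℕ, ∀ z ∈ D, z.natAbs ≤ N := by
    obtain ⟨N, hN⟩ := (hD.image Int.natAbs).bddAbove
    exact ⟨N, fun z hz => hN ⟨z, hz, rfl⟩⟩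
  obtain ⟨P, hP, hprime⟩ := Nat.exists_infinite_primes (2 * N + 1)
  have : NeZero P := ⟨hprime.ne_zero⟩
  refine ⟨P, hprime, fun z hz => valMinAbs_intCast ?_⟩
  have := hN z hz
  rw [Int.abs_eq_natAbs]
  omega

end Alphabets


/-! ### The two cases of the theorem -/

/-- Two linear combinations over a finite field. -/
theorem achievable_finiteField {K : ℕ} {X : Fin K → Type*} [∀ k, MeasurableSpace (X k)]
    {Y : Type*} [MeasurableSpace Y] (W : Kernel (∀ k, X k) Y) [IsMarkovKernel W]
    {F : Type*} [Field F] [Fintype F] [MeasurableSpace F] [DiscreteMeasurableSpace F]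
    {a₁ a₂ : Fin K → F} (hli : LinearIndependent F ![a₁, a₂]) (p : Fin K → PMF F)
    (x : ∀ k, F → X k) {R : Fin K → ℝ} (hR : ∀ k, 0 ≤ R k)
    (hout : ∀ k, a₁ k = 0 → a₂ k = 0 → R k ≤ Real.logb 2 (Fintype.card F))
    (hreg : R ∈ region₁ W p x a₁ a₂ ∪ region₂ W p x a₁ a₂) : Achievable W ![a₁, a₂] R := by
  have hne : ∀ l, ∃ k, ![a₁, a₂] l k ≠ 0 := fun l => Function.ne_iff.1 (hli.ne_zero l)
  obtain ⟨b, hb⟩ := exists_meetsRates W hne hreg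
  have hred : IsReduction (RingHom.id F) id p ![a₁, a₂] :=
    ⟨fun _ => rfl, fun _ _ _ => rfl, fun _ _ h => h, fun _ _ _ => rfl⟩
  refine hred.achievable_of_meetsRates W x (j := RingHom.id F) Function.injective_id hne hR
    (fun n k => nonempty_embedding_of_le_logb ?_ n) (fun _ _ => rfl) hb
  by_cases hk : a₁ k ≠ 0 ∨ a₂ k ≠ 0
  · exact (hb.lt_entropy W hk).le.trans (entropy_rvU_le W p x k)
  · push Not at hk
    exact hout k hk.1 hk.2

/-- Two integer linear combinations over the reals. -/
theorem achievable_integers {K : ℕ} {X : Fin K → Type*} [∀ k, MeasurableSpace (X k)]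
    {Y : Type*} [MeasurableSpace Y] (W : Kernel (∀ k, X k) Y) [IsMarkovKernel W]
    {a₁ a₂ : Fin K → ℤ}
    (hli : LinearIndependent ℝ ![fun k => (a₁ k : ℝ), fun k => (a₂ k : ℝ)])
    {p : Fin K → PMF ℤ} (hp : ∀ k, (p k).support.Finite) (x : ∀ k, ℤ → X k) {R : Fin K → ℝ}
    (hR : ∀ k, 0 ≤ R k) (hreg : R ∈ region₁ W p x a₁ a₂ ∪ region₂ W p x a₁ a₂) :
    Achievable W ![fun k => (a₁ k : ℝ), fun k => (a₂ k : ℝ)] R := by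
  have hne : ∀ l, ∃ k, ![a₁, a₂] l k ≠ 0 := by
    intro l
    obtain ⟨k, hk⟩ := Function.ne_iff.1 (hli.ne_zero l)
    refine ⟨k, fun h => hk ?_⟩
    fin_cases l <;> simpa using h
  obtain ⟨b, hb⟩ := exists_meetsRates W hne hreg
  have hU : {u : Fin K → ℤ | ∀ k, p k (u k) ≠ 0}.Finite := by
    refine (Set.Finite.pi hp).subset fun u hu k _ => ?_
    exact (PMF.mem_support_iff _ _).2 (hu k)
  -- The prime must separate the symbols, keep nonzero coefficients nonzero, and recover both
  -- combinations as well as V_b for the chosen `b`. These are finitely many integers because the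
  -- supports are finite.
  obtain ⟨P, hprime, hP⟩ := exists_prime_valMinAbs
    (((Set.finite_iUnion hp).union (Set.finite_range fun lk : Fin 2 × Fin K =>
      ![a₁, a₂] lk.1 lk.2)).union ((Set.finite_iUnion fun l : Fin 2 =>
        hU.image fun u => ∑ k, ![a₁, a₂] l k * u k).union
      (hU.image fun u => b 0 * ∑ k, a₁ k * u k + b 1 * ∑ k, a₂ k * u k)))
  have : Fact P.Prime := ⟨hprime⟩
  let _ : MeasurableSpace (ZMod P) := ⊤
  have : DiscreteMeasurableSpace (ZMod P) := ⟨fun _ => trivial⟩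
  have hred : IsReduction (Int.castRingHom (ZMod P)) ZMod.valMinAbs p ![a₁, a₂] := by
    refine ⟨fun v => by simp, fun k s hs => ?_, fun l k h h0 => ?_, fun u hu l => ?_⟩
    · exact hP s (Or.inl (Or.inl (Set.mem_iUnion.2 ⟨k, (PMF.mem_support_iff _ _).2 hs⟩)))
    · have h1 := hP _ (Or.inl (Or.inr ⟨(l, k), rfl⟩))
      rw [eq_intCast] at h0
      simp only [h0, ZMod.valMinAbs_zero] at h1
      exact h h1.symm
    · exact hP _ (Or.inr (Or.inl (Set.mem_iUnion.2 ⟨l, u, hu, rfl⟩)))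
  exact hred.achievable_of_meetsRates W x (j := Int.castRingHom ℝ) Int.cast_injective hne hR
    (fun n k => nonempty_embedding_of_infinite (R k) n)
    (fun u hu => hP _ (Or.inr (Or.inr ⟨u, hu, rfl⟩))) hb

end ComputeForward

theorem theorem4 {K : ℕ} {X : Fin K → Type*} [∀ k, MeasurableSpace (X k)]
    {Y : Type*} [MeasurableSpace Y] (W : Kernel (∀ k, X k) Y) [IsMarkovKernel W]
    {F : Type*} [Field F] [Fintype F] [MeasurableSpace F] [DiscreteMeasurableSpace F] :
    (∀ a₁ a₂ : Fin K → F, LinearIndependent F ![a₁, a₂] →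
      ∀ (p : Fin K → PMF F) (x : ∀ k, F → X k) (R : Fin K → ℝ),
        (∀ k, 0 ≤ R k) →
        (∀ k, a₁ k = 0 → a₂ k = 0 → R k ≤ Real.logb 2 (Fintype.card F)) →
        R ∈ ComputeForward.region₁ W p x a₁ a₂ ∪ ComputeForward.region₂ W p x a₁ a₂ →
        ComputeForward.Achievable W ![a₁, a₂] R) ∧
    (∀ a₁ a₂ : Fin K → ℤ,
      LinearIndependent ℝ ![fun k => (a₁ k : ℝ), fun k => (a₂ k : ℝ)] →
      ∀ (p : Fin K → PMF ℤ), (∀ k, (p k).support.Finite) →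
      ∀ (x : ∀ k, ℤ → X k) (R : Fin K → ℝ),
        (∀ k, 0 ≤ R k) →
        R ∈ ComputeForward.region₁ W p x a₁ a₂ ∪ ComputeForward.region₂ W p x a₁ a₂ →
        ComputeForward.Achievable W ![fun k => (a₁ k : ℝ), fun k => (a₂ k : ℝ)] R) := by
  exact ⟨fun a₁ a₂ hli p x R hR hout hreg =>
      ComputeForward.achievable_finiteField W hli p x hR hout hreg,
    fun a₁ a₂ hli p hp x R hR hreg => ComputeForward.achievable_integers W hli hp x hR hreg⟩
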